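/- Let $\lambda>2$ be a rational number. An (a,b)-module is a free $\mathbb{C}[[b]]$-module of finite rank with a $\mathbb{C}$-linear, $b$-adically continuous operator $a$ such that $ab-ba=b^2$. For $\mu\in\,]0,1]\cap\mathbb{Q}$ let $\Xi_\mu^{(N)}=\bigoplus_{j=0}^N\mathbb{C}[[b]]\,e_{\mu,j}$ with $a e_{\mu,j}=\mu b\,e_{\mu,j}+b\,e_{\mu,j-1}$ (where $e_{\mu,-1}=0$), and let $\Xi_\Lambda^{(N)}=\bigoplus_{\mu\in\Lambda}\Xi_\mu^{(N)}$ for $\Lambda\subset\,]0,1]\cap\mathbb{Q}$ finite. A $[\lambda]$-primitive theme is an (a,b)-module isomorphic to the sub-(a,b)-module generated by one element of some $\Xi_\mu^{(N)}$, with $\mu\equiv\lambda$ mod $\mathbb{Z}$. A rank $3$ such theme $E$ has fundamental invariants $\lambda_1=\lambda$, $p_1=p_2=1$ when it has a filtration $0=F_0\subset F_1\subset F_2\subset F_3=E$ by $a$-stable submodules whose successive quotients are free of rank one on a generator $e$ with $ae=\lambda b\,e$. It is called invariant when it has an endomorphism (a $\mathbb{C}[[b]]$-linear map commuting with $a$)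 of rank $2$. For $\alpha,\beta\in\mathbb{C}^*$ and $\gamma\in\mathbb{C}$ let $E(\alpha,\beta,\gamma)=\tilde{\mathcal A}/\tilde{\mathcal A}(a-\lambda b)(1+\beta b+\gamma b^2)^{-1}(a-\lambda b)(1+\alpha b)^{-1}(a-\lambda b)$, where $\tilde{\mathcal A}$ is the $b$-completion of $\mathbb{C}\langle a,b\rangle/(ab-ba-b^2)$; that is, the free $\mathbb{C}[[b]]$-module with basis $e_1,e_2,e_3$ and $(a-\lambda b)e_3=(1+\alpha b)e_2$, $(a-\lambda b)e_2=(1+\beta b+\gamma b^2)e_1$, $(a-\lambda b)e_1=0$. These are the canonical forms of the rank $3$ themes with invariants $\lambda_1=\lambda$, $p_1=p_2=1$. On a reduced complex space $X$, a holomorphic family of such themes is a locally free sheaf $\mathbb{E}$ of finite type of $\mathcal{O}_X[[b]]$-modules with an action of $a$, whose fibers $E(x)$ are rank $3$ $[\lambda]$-primitive themes with these invariants, and which is locally isomorphic to the sheaf generated by a holomorphic map $\varphi$ to some $\Xi_\Lambda^{(2)}$ such that $\varphi,a\varphi,a^2\varphi$ is a basis of the sheaf generated by the $a^\nu\varphi$,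 whose fiber at $x$ is the submodule generated by $\varphi(x)$. The family is universal near $x_0\in X$ when, for every reduced complex space $Y$ with a base point $y_0$ and every holomorphic family $\mathbb{H}$ of such themes on $Y$ with $H(y_0)\simeq E(x_0)$, there is a holomorphic map $f$ from a neighbourhood of $y_0$ to $X$ with $f(y_0)=x_0$ and $f^*\mathbb{E}\simeq\mathbb{H}$ near $y_0$, and the germ of $f$ at $y_0$ is unique. Then every $E(\alpha,\beta,\gamma)$ with $\alpha\beta\neq0$ is a rank $3$ $[\lambda]$-primitive theme with fundamental invariants $\lambda_1=\lambda$, $p_1=p_2=1$, and: (1) For $\alpha\ne\beta$ in $\mathbb{C}^*$ and any $\gamma$, the theme $E(\alpha,\beta,\gamma)$ is not invariant and its canonical form is not unique: it is isomorphic to $E(\alpha',\beta',\gamma')$ for some $(\alpha',\beta',\gamma')\neq(\alpha,\beta,\gamma)$ in $(\mathbb{C}^*)^2\times\mathbb{C}$. (2) For $\alpha\in\mathbb{C}^*$ and any $\gamma$, the theme $E(\alpha,\alpha,\gamma)$ is invariant, but no holomorphic family of such themes, on any reduced complex space $X$, is universal near a point $x_0\in X$ with $E(x_0)\simeq E(\alpha,\alpha,\gamma)$.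 (3) For $\alpha\neq\beta$ in $\mathbb{C}^*$ and any $\gamma$, there is a holomorphic family of such themes on a smooth complex space of dimension $2$ which is universal near each point of this space, in which no isomorphism class appears twice, and which has a fiber isomorphic to $E(\alpha,\beta,\gamma)$. -/

import Mathlib

open Filter Topology

/-- The ring `ℂ[[b]]`; the variable `b` is `PowerSeries.X`. -/
abbrev Cb : Type := PowerSeries ℂ

/-- The variable `b` of `ℂ[[b]]`. -/
noncomputable abbrev bVar : Cb := PowerSeries.X

/-- A complex number as a constant series. -/
noncomputable abbrev cst (c : ℂ) : Cb := PowerSeries.C c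

/-- Derivative with respect to `b`. -/
noncomputable abbrev bDeriv (S : Cb) : Cb := PowerSeries.derivative ℂ S

/-- A `ℂ[[b]]`-module with an operator `a` such that `a S = S a + b² S'` for `S ∈ ℂ[[b]]`, i.e. `a` is
`ℂ`-linear, `b`-adically continuous and `a b - b a = b²`.  It is an (a,b)-module when it is
moreover free of finite rank over `ℂ[[b]]`. -/
class ABModule (E : Type*) [AddCommGroup E] [Module Cb E] where
  a : E →+ E
  a_smul : ∀ (S : Cb) (v : E), a (S • v) = S • a v + (bVar ^ 2 * bDeriv S) • v

/-- The iterate `a^j v`. -/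
def aPow {E : Type*} [AddCommGroup E] [Module Cb E] [ABModule E] (j : ℕ) (v : E) : E :=
  (ABModule.a : E →+ E)^[j] v

/-- A `ℂ[[b]]`-linear map that commutes with `a`. -/
def IsABLinear {E F : Type*} [AddCommGroup E] [Module Cb E] [ABModule E]
    [AddCommGroup F] [Module Cb F] [ABModule F] (θ : E →ₗ[Cb] F) : Prop :=
  ∀ v : E, θ (ABModule.a v) = ABModule.a (θ v)

/-- `E` and `F` are isomorphic. -/
def ABIsomorphic (E F : Type*) [AddCommGroup E] [Module Cb E] [ABModule E]
    [AddCommGroup F] [Module Cb F] [ABModule F] : Prop :=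
  ∃ θ : E →ₗ[Cb] F, IsABLinear θ ∧ Function.Bijective θ

/-- The underlying module of `Ξ_Λ^{(N)} = ⊕_{μ ∈ Λ} ⊕_{j ≤ N} ℂ[[b]] e_{μ,j}`. -/
def Xi (Λ : Finset ℚ) (N : ℕ) : Type := Λ → Fin (N + 1) → Cb

noncomputable instance (Λ : Finset ℚ) (N : ℕ) : AddCommGroup (Xi Λ N) :=
  inferInstanceAs (AddCommGroup (Λ → Fin (N + 1) → Cb))

noncomputable instance (Λ : Finset ℚ) (N : ℕ) : Module Cb (Xi Λ N) :=
  inferInstanceAs (Module Cb (Λ → Fin (N + 1) → Cb))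

/-- `a e_{μ,0} = μ b e_{μ,0}` and `a e_{μ,j} = μ b e_{μ,j} + b e_{μ,j-1}`. -/
noncomputable instance (Λ : Finset ℚ) (N : ℕ) : ABModule (Xi Λ N) where
  a :=
    { toFun := fun x μ j =>
        cst ((μ : ℚ) : ℂ) * bVar * x μ j + bVar ^ 2 * bDeriv (x μ j)
          + (if h : (j : ℕ) + 1 < N + 1 then bVar * x μ ⟨(j : ℕ) + 1, h⟩ else 0)
      map_zero' := by
        funext μ j
        change _ * (0 : Cb) + _ * bDeriv (0 : Cb) + (if h : _ then _ * (0 : Cb) else 0) = (0 : Cb)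
        simp
      map_add' := fun x y => by
        funext μ j
        change _ * (x μ j + y μ j) + _ * bDeriv (x μ j + y μ j)
            + (if h : _ then _ * (x μ _ + y μ _) else 0) = (_ + (dite _ _ _)) + (_ + (dite _ _ _))
        simp only [bDeriv, map_add]
        split_ifs <;> ring }
  a_smul := fun S x => by
    funext μ j
    change _ * (S * x μ j) + _ * bDeriv (S * x μ j)
        + (if h : _ then _ * (S * x μ _) else 0)
        = S * (_ + (dite _ _ _)) + (bVar ^ 2 * bDeriv S) * x μ j
    simp only [bDeriv, Derivation.leibniz, smul_eq_mul, smul_eq_mul]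
    split_ifs <;> ring

/-- The underlying module `ℂ[[b]] e₁ ⊕ ℂ[[b]] e₂ ⊕ ℂ[[b]] e₃` of the theme `E(α,β,γ)`
with fundamental invariants `λ₁ = lam`, `p₁ = p₂ = 1`. -/
@[nolint unusedArguments]
def CanonicalTheme (_lam : ℚ) (_α _β _γ : ℂ) : Type := Fin 3 → Cb

noncomputable instance (lam : ℚ) (α β γ : ℂ) : AddCommGroup (CanonicalTheme lam α β γ) :=
  inferInstanceAs (AddCommGroup (Fin 3 → Cb))

noncomputable instance (lam : ℚ) (α β γ : ℂ) : Module Cb (CanonicalTheme lam α β γ) :=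
  inferInstanceAs (Module Cb (Fin 3 → Cb))

/-- The operator `a` of `E(α,β,γ)` in the coordinates `x 0 e₁ + x 1 e₂ + x 2 e₃`. -/
noncomputable def canonicalA (lam : ℚ) (α β γ : ℂ) (x : Fin 3 → Cb) : Fin 3 → Cb :=
  ![cst (lam : ℂ) * bVar * x 0 + bVar ^ 2 * bDeriv (x 0)
      + (1 + cst β * bVar + cst γ * bVar ^ 2) * x 1,
    cst (lam : ℂ) * bVar * x 1 + bVar ^ 2 * bDeriv (x 1) + (1 + cst α * bVar) * x 2,
    cst (lam : ℂ) * bVar * x 2 + bVar ^ 2 * bDeriv (x 2)]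

theorem canonicalA_zero (lam : ℚ) (α β γ : ℂ) : canonicalA lam α β γ 0 = 0 := by
  funext i
  fin_cases i <;> simp [canonicalA]

theorem canonicalA_add (lam : ℚ) (α β γ : ℂ) (x y : Fin 3 → Cb) :
    canonicalA lam α β γ (x + y) = canonicalA lam α β γ x + canonicalA lam α β γ y := by
  funext i
  fin_cases i <;> simp [canonicalA] <;> ring

theorem canonicalA_smul (lam : ℚ) (α β γ : ℂ) (S : Cb) (x : Fin 3 → Cb) :
    canonicalA lam α β γ (S • x)
      = S • canonicalA lam α β γ x + (bVar ^ 2 * bDeriv S) • x := by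
  funext i
  fin_cases i <;> simp [canonicalA] <;> ring

/-- `(a - λ b) e₃ = (1 + α b) e₂`, `(a - λ b) e₂ = (1 + β b + γ b²) e₁`, `(a - λ b) e₁ = 0`; that is,
the quotient of the `b`-completed algebra generated by `a` and `b` by the left ideal of
`(a - λ b) (1 + β b + γ b²)⁻¹ (a - λ b) (1 + α b)⁻¹ (a - λ b)`, with `e₃` the class of `1`. -/
noncomputable instance (lam : ℚ) (α β γ : ℂ) : ABModule (CanonicalTheme lam α β γ) where
  a :=
    { toFun := canonicalA lam α β γ
      map_zero' := canonicalA_zero lam α β γ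
      map_add' := canonicalA_add lam α β γ }
  a_smul := canonicalA_smul lam α β γ

/-- `E` is a `[lam]`-primitive theme: it is isomorphic to the submodule generated over `ℂ[[b]]` and `a`
by one element `φ` of some `Ξ_μ^{(N)}`, where `μ ∈ ]0,1]` is congruent to `lam` modulo `ℤ`. -/
def IsPrimitiveTheme (lam : ℚ) (E : Type*) [AddCommGroup E] [Module Cb E] [ABModule E] : Prop :=
  ∃ μ : ℚ, 0 < μ ∧ μ ≤ 1 ∧ (∃ m : ℤ, lam = μ + m) ∧
    ∃ (N : ℕ) (φ : Xi {μ} N) (θ : E →ₗ[Cb] Xi {μ} N),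
      IsABLinear θ ∧ Function.Injective θ ∧
        LinearMap.range θ = Submodule.span Cb (Set.range fun ν : ℕ => aPow ν φ)

/-- `E` has a filtration `0 = F₀ ⊂ F₁ ⊂ ⋯ ⊂ F_k = E` by submodules stable by `a` with
`F_j / F_{j-1}` free of rank one on a generator `e` with `a e = λ_j b e`; here
`F_j` is spanned by the first `j` vectors of a basis.
For a primitive theme the `F_j` are its normal submodules. The integers `p_j` are given by
`λ_{j+1} = λ_j + p_j - 1`. -/
def HasFundamentalInvariants {k : ℕ} (lams : Fin k → ℚ)
    (E : Type*) [AddCommGroup E] [Module Cb E] [ABModule E] : Prop :=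
  ∃ e : Module.Basis (Fin k) Cb E, ∀ j : Fin k,
    ABModule.a (e j) - (cst (lams j : ℂ) * bVar) • e j ∈ Submodule.span Cb (e '' {i | i < j})

/-- `E` is a primitive theme of rank `k` with fundamental invariants `λ₁, …, λ_k`. -/
def IsThemeWithInvariants {k : ℕ} (lams : Fin k → ℚ)
    (E : Type*) [AddCommGroup E] [Module Cb E] [ABModule E] : Prop :=
  (∀ j, IsPrimitiveTheme (lams j) E) ∧ HasFundamentalInvariants lams E

/-- A theme of rank `k` is invariant when it has an endomorphism of rank `k - 1`. -/
def IsInvariantTheme (E : Type*) [AddCommGroup E] [Module Cb E] [ABModule E] : Prop :=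
  ∃ u : E →ₗ[Cb] E, IsABLinear u ∧
    Module.finrank Cb (LinearMap.range u) + 1 = Module.finrank Cb E

universe u v w w'

/-- `e` identifies `U` with the subset `A` of `ℂⁿ` in such a way that the functions
satisfying `H` at a point are those which are, near this point, restrictions to `A` of holomorphic functions of
`n` variables. -/
def IsHolChart {M : Type u} [TopologicalSpace M] (H : (M → ℂ) → M → Prop) {n : ℕ}
    {U : Set M} {A : Set (Fin n → ℂ)} (e : U ≃ₜ A) : Prop :=
  ∀ (f : M → ℂ) (y : U), H f y ↔
    ∃ G : (Fin n → ℂ) → ℂ, AnalyticAt ℂ G (e y) ∧ ∀ᶠ z : U in 𝓝 y, f z = G (e z)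

/-- A reduced complex space: a Hausdorff space with a sheaf of `ℂ`-valued functions, locally isomorphic to
the zero set of finitely many holomorphic functions on an open subset of some `ℂⁿ`.
`IsHolAt f x` says that `f` is a section of the sheaf on some neighbourhood of `x`. -/
class ReducedComplexSpace (M : Type u) [TopologicalSpace M] where
  t2 : T2Space M
  IsHolAt : (M → ℂ) → M → Prop
  exists_chart : ∀ x : M, ∃ (U : Set M) (n m : ℕ) (D : Set (Fin n → ℂ))
    (F : Fin m → (Fin n → ℂ) → ℂ),
    IsOpen U ∧ x ∈ U ∧ IsOpen D ∧ (∀ i, AnalyticOnNhd ℂ (F i) D) ∧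
      ∃ e : U ≃ₜ {z : Fin n → ℂ | z ∈ D ∧ ∀ i, F i z = 0}, IsHolChart IsHolAt e

/-- `M` is smooth of pure dimension `d`: it is locally isomorphic to open subsets of `ℂᵈ`. -/
def IsSmoothOfDim (d : ℕ) (M : Type u) [TopologicalSpace M] [ReducedComplexSpace M] : Prop :=
  ∀ x : M, ∃ (U : Set M) (D : Set (Fin d → ℂ)), IsOpen U ∧ x ∈ U ∧ IsOpen D ∧
    ∃ e : U ≃ₜ D, IsHolChart (ReducedComplexSpace.IsHolAt (M := M)) e

/-- `f` restricts to a holomorphic map on the open set `U`. -/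
def IsHolMapOn {M : Type u} {N : Type v} [TopologicalSpace M] [ReducedComplexSpace M]
    [TopologicalSpace N] [ReducedComplexSpace N] (f : M → N) (U : Set M) : Prop :=
  ContinuousOn f U ∧ ∀ y ∈ U, ∀ g : N → ℂ,
    ReducedComplexSpace.IsHolAt g (f y) → ReducedComplexSpace.IsHolAt (g ∘ f) y

/-- `S` is a section of `𝒪[[b]]` near `x`: there is a neighbourhood of `x` on which
all the coefficients of `S` are holomorphic. -/
def IsHolSeriesAt {M : Type u} [TopologicalSpace M] [ReducedComplexSpace M]
    (S : M → Cb) (x : M) : Prop :=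
  ∀ᶠ z in 𝓝 x, ∀ n : ℕ, ReducedComplexSpace.IsHolAt (fun y => PowerSeries.coeff n (S y)) z

/-- A sheaf of `𝒪_M`-(a,b)-modules on the reduced complex space `M`, given by its fibers and its sections:
since `M` is reduced, a section of the locally free sheaf on an open set is determined by its
values in the fibers. `IsHolAt t x` says that `t` is a section of the sheaf near `x`. -/
structure ABFamily (M : Type u) [TopologicalSpace M] [ReducedComplexSpace M] where
  fib : M → Type w
  [grp : ∀ x, AddCommGroup (fib x)]
  [mod : ∀ x, Module Cb (fib x)]
  [ab : ∀ x, ABModule (fib x)]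
  IsHolAt : (∀ x, fib x) → M → Prop
  /-- The sheaf is locally free of finite type over `𝒪_M[[b]]`, with the given fibers. -/
  exists_frame : ∀ x₀ : M, ∃ (U : Set M) (k : ℕ) (s : Fin k → ∀ x, fib x),
    IsOpen U ∧ x₀ ∈ U ∧ ∀ x ∈ U,
      (LinearIndependent Cb (fun i => s i x) ∧
        Submodule.span Cb (Set.range fun i => s i x) = ⊤) ∧
      ∀ t : ∀ x, fib x, IsHolAt t x ↔ ∃ g : Fin k → M → Cb,
        (∀ i, IsHolSeriesAt (g i) x) ∧ ∀ᶠ z in 𝓝 x, t z = ∑ i, g i z • s i z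
  /-- The sheaf is stable by `a`. -/
  a_hol : ∀ (t : ∀ x, fib x) (x : M), IsHolAt t x → IsHolAt (fun y => ABModule.a (t y)) x

attribute [instance] ABFamily.grp ABFamily.mod ABFamily.ab

/-- The map `φ : U → Ξ_Λ^{(N)}` is holomorphic and `k`-thematic on `U`: the sheaf generated by the
`a^ν φ` has basis `φ, a φ, …, a^{k-1} φ` and its fiber at `x` is the submodule
of `Ξ_Λ^{(N)}` generated by `φ(x)`. -/
def IsThematicOn {M : Type u} [TopologicalSpace M] [ReducedComplexSpace M] {Λ : Finset ℚ} {N : ℕ}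
    (k : ℕ) (φ : M → Xi Λ N) (U : Set M) : Prop :=
  (∀ x ∈ U, ∀ μ j, IsHolSeriesAt (fun y => φ y μ j) x) ∧
  (∀ x ∈ U, LinearIndependent Cb (fun j : Fin k => aPow j (φ x))) ∧
  ∃ S : Fin k → M → Cb, (∀ j, ∀ x ∈ U, IsHolSeriesAt (S j) x) ∧
    ∀ x ∈ U, aPow k (φ x) = ∑ j : Fin k, S j x • aPow j (φ x)

/-- The restriction of `𝔼` to `U` is isomorphic, as a sheaf with its action of `a`, to the subsheaf of
`Ξ_{U,Λ}^{(N)}` with basis `φ, a φ, …, a^{k-1} φ`. -/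
def ABFamily.IsIsoThematicOn {M : Type u} [TopologicalSpace M] [ReducedComplexSpace M]
    (𝔼 : ABFamily.{u, w} M) {Λ : Finset ℚ} {N : ℕ}
    (k : ℕ) (φ : M → Xi Λ N) (U : Set M) : Prop :=
  ∃ θ : ∀ x, 𝔼.fib x →ₗ[Cb] Xi Λ N, ∀ x ∈ U,
    IsABLinear (θ x) ∧ Function.Injective (θ x) ∧
    LinearMap.range (θ x) = Submodule.span Cb (Set.range fun j : Fin k => aPow j (φ x)) ∧
    ∀ t : ∀ x, 𝔼.fib x, 𝔼.IsHolAt t x ↔ ∃ g : Fin k → M → Cb,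
      (∀ j, IsHolSeriesAt (g j) x) ∧
        ∀ᶠ z in 𝓝 x, θ z (t z) = ∑ j : Fin k, g j z • aPow j (φ z)

/-- `𝔼` is a holomorphic family of primitive themes of rank `k` with fundamental invariants
`λ₁, …, λ_k`. -/
def ABFamily.IsHolFamily {M : Type u} [TopologicalSpace M] [ReducedComplexSpace M]
    (𝔼 : ABFamily.{u, w} M) {k : ℕ} (lams : Fin k → ℚ) : Prop :=
  (∀ x, IsThemeWithInvariants lams (𝔼.fib x)) ∧
  ∀ x₀ : M, ∃ (U : Set M) (Λ : Finset ℚ) (φ : M → Xi Λ (k - 1)),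
    IsOpen U ∧ x₀ ∈ U ∧ (∀ μ ∈ Λ, 0 < μ ∧ μ ≤ 1) ∧
      IsThematicOn k φ U ∧ 𝔼.IsIsoThematicOn k φ U

/-- Sections near `y` of the pull back of `𝔼` by `f`, whose fiber at `y` is `E(f(y))`: they are, locally,
the combinations with coefficients in `𝒪[[b]]` of pull backs of sections of `𝔼`. -/
def ABFamily.IsPullbackHolAt {M : Type u} {N : Type v}
    [TopologicalSpace M] [ReducedComplexSpace M] [TopologicalSpace N] [ReducedComplexSpace N]
    (𝔼 : ABFamily.{u, w} M) (f : N → M) (t : ∀ y, 𝔼.fib (f y)) (y : N) : Prop :=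
  ∃ (n : ℕ) (s : Fin n → ∀ x, 𝔼.fib x) (g : Fin n → N → Cb),
    (∀ i, 𝔼.IsHolAt (s i) (f y)) ∧ (∀ i, IsHolSeriesAt (g i) y) ∧
      ∀ᶠ z in 𝓝 y, t z = ∑ i, g i z • s i (f z)

/-- `f` is a holomorphic map on an open neighbourhood of `y₀` with `f y₀ = x₀`, such that the
pull back of `𝔼` by `f` is isomorphic to `ℍ` on this neighbourhood. -/
def IsClassifyingMapAt {M : Type u} {N : Type v}
    [TopologicalSpace M] [ReducedComplexSpace M] [TopologicalSpace N] [ReducedComplexSpace N]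
    (𝔼 : ABFamily.{u, w} M) (x₀ : M) (ℍ : ABFamily.{v, w'} N) (y₀ : N) (f : N → M) : Prop :=
  f y₀ = x₀ ∧ ∃ U : Set N, IsOpen U ∧ y₀ ∈ U ∧ IsHolMapOn f U ∧
    ∃ θ : ∀ y, 𝔼.fib (f y) →ₗ[Cb] ℍ.fib y, ∀ y ∈ U,
      IsABLinear (θ y) ∧ Function.Bijective (θ y) ∧
      ∀ t : ∀ y, 𝔼.fib (f y), 𝔼.IsPullbackHolAt f t y ↔ ℍ.IsHolAt (fun z => θ z (t z)) y

/-- `𝔼` is universal near `x₀`: every holomorphic family `ℍ` of themes with the same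
fundamental invariants, whose fiber at `y₀` is isomorphic to that of `𝔼` at `x₀`, is near `y₀`
the pull back of `𝔼` by a holomorphic map sending `y₀` to `x₀`, and the germ of this map at `y₀`
is unique. -/
def ABFamily.IsUniversalNear {M : Type u} [TopologicalSpace M] [ReducedComplexSpace M]
    (𝔼 : ABFamily.{u, w} M) {k : ℕ} (lams : Fin k → ℚ) (x₀ : M) : Prop :=
  ∀ (N : Type v) [TopologicalSpace N] [ReducedComplexSpace N] (ℍ : ABFamily.{v, w'} N) (y₀ : N),
    ℍ.IsHolFamily lams → ABIsomorphic (ℍ.fib y₀) (𝔼.fib x₀) →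
      (∃ f : N → M, IsClassifyingMapAt 𝔼 x₀ ℍ y₀ f) ∧
      ∀ f f' : N → M, IsClassifyingMapAt 𝔼 x₀ ℍ y₀ f → IsClassifyingMapAt 𝔼 x₀ ℍ y₀ f' →
        f =ᶠ[𝓝 y₀] f'

namespace ReducedComplexSpace

/-!
Comparing coefficients, a homomorphism between two canonical forms is an upper triangular matrix
determined by three constants, among them its diagonal entry `c`. It follows that `α` and `β` are
invariants of the isomorphism class, and that the shear with parameter `x` carries `γ` to `γ'`
exactly when `x(β - α) = γ - γ'`; hence `γ` is arbitrary when `α ≠ β` and an invariant when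
`α = β`. An endomorphism of rank 2 has `c = 0` and needs a nonzero entry above the diagonal, which
forces `α = β`. Embedding a holomorphic family in `Ξ_Λ^{(2)}` and reading off coefficients of a
generator brings it locally to canonical form with holomorphic `α, β, γ`, so the family `E(α,β,0)`
over the pairs `α ≠ β` is universal.

Near `E(α,α,γ)` take the family with fibers `E(α, α e^s, γ + t)` over `ℂ²`. Its pull backs by
`(s, t) ↦ (s, t(e^s - 1))` and by `(s, t) ↦ (s, 0)` are isomorphic, as the factor `e^s - 1` is
absorbed by a holomorphic shear. A classifying map is thus the same after composition with these
two maps, so it only depends on `s`, although the fibers over `s = 0` are pairwise non-isomorphic.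
-/

variable {M : Type u} [TopologicalSpace M] [ReducedComplexSpace M]

theorem isHolAt_comp_analyticAt {k : ℕ} {F : Fin k → M → ℂ} {x : M} (hF : ∀ i, IsHolAt (F i) x)
    {Φ : (Fin k → ℂ) → ℂ} (hΦ : AnalyticAt ℂ Φ (fun i => F i x)) :
    IsHolAt (fun y => Φ (fun i => F i y)) x := by
  obtain ⟨U, n, m, D, P, -, hx, -, -, e, he⟩ := exists_chart x
  have hF' := fun i => (he (F i) ⟨x, hx⟩).1 (hF i)
  choose G hG hFG using hF'
  refine (he _ ⟨x, hx⟩).2 ⟨fun z => Φ (fun i => G i z), ?_, ?_⟩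
  · have h0 : (fun i => F i x) = fun i => G i (e ⟨x, hx⟩) := by
      funext i
      exact (hFG i).self_of_nhds
    rw [h0] at hΦ
    exact AnalyticAt.fun_comp hΦ (AnalyticAt.pi hG)
  · filter_upwards [eventually_all.2 hFG] with z hz
    simp only [hz]

theorem isHolAt_const (c : ℂ) (x : M) : IsHolAt (fun _ : M => c) x :=
  isHolAt_comp_analyticAt (F := Fin.elim0) (Φ := fun _ => c) (fun i => i.elim0) analyticAt_const

theorem IsHolAt.comp_analyticAt {f : M → ℂ} {x : M} (hf : IsHolAt f x) {Φ : ℂ → ℂ}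
    (hΦ : AnalyticAt ℂ Φ (f x)) : IsHolAt (fun y => Φ (f y)) x :=
  isHolAt_comp_analyticAt (F := fun _ : Fin 1 => f) (Φ := fun z => Φ (z 0)) (fun _ => hf)
    (AnalyticAt.fun_comp (g := Φ) (f := fun z : Fin 1 → ℂ => z 0) hΦ
      ((ContinuousLinearMap.proj (R := ℂ) (φ := fun _ : Fin 1 => ℂ) 0).analyticAt _))

theorem analyticAt_coord {n : ℕ} (i : Fin n) (z : Fin n → ℂ) :
    AnalyticAt ℂ (fun z : Fin n → ℂ => z i) z :=
  (ContinuousLinearMap.proj (R := ℂ) (φ := fun _ : Fin n => ℂ) i).analyticAt _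

theorem IsHolAt.add {f g : M → ℂ} {x : M} (hf : IsHolAt f x) (hg : IsHolAt g x) :
    IsHolAt (fun y => f y + g y) x :=
  isHolAt_comp_analyticAt (F := ![f, g]) (Φ := fun z => z 0 + z 1)
    (by simp [Fin.forall_fin_two, hf, hg]) ((analyticAt_coord 0 _).add (analyticAt_coord 1 _))

theorem IsHolAt.mul {f g : M → ℂ} {x : M} (hf : IsHolAt f x) (hg : IsHolAt g x) :
    IsHolAt (fun y => f y * g y) x :=
  isHolAt_comp_analyticAt (F := ![f, g]) (Φ := fun z => z 0 * z 1)
    (by simp [Fin.forall_fin_two, hf, hg]) ((analyticAt_coord 0 _).mul (analyticAt_coord 1 _))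

theorem IsHolAt.neg {f : M → ℂ} {x : M} (hf : IsHolAt f x) : IsHolAt (fun y => -f y) x :=
  hf.comp_analyticAt (Φ := fun z => -z) analyticAt_id.neg

theorem IsHolAt.sub {f g : M → ℂ} {x : M} (hf : IsHolAt f x) (hg : IsHolAt g x) :
    IsHolAt (fun y => f y - g y) x := by
  simpa only [sub_eq_add_neg] using hf.add hg.neg

theorem IsHolAt.inv {f : M → ℂ} {x : M} (hf : IsHolAt f x) (h0 : f x ≠ 0) :
    IsHolAt (fun y => (f y)⁻¹) x :=
  hf.comp_analyticAt (Φ := fun z => z⁻¹) (analyticAt_inv h0)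

theorem IsHolAt.div {f g : M → ℂ} {x : M} (hf : IsHolAt f x) (hg : IsHolAt g x) (h0 : g x ≠ 0) :
    IsHolAt (fun y => f y / g y) x := by
  simpa only [div_eq_mul_inv] using hf.mul (hg.inv h0)

theorem isHolAt_sum {ι : Type*} (s : Finset ι) {f : ι → M → ℂ} {x : M}
    (hf : ∀ i ∈ s, IsHolAt (f i) x) : IsHolAt (fun y => ∑ i ∈ s, f i y) x := by
  simpa only [← Finset.sum_apply] using Finset.sum_induction f (IsHolAt · x)
    (fun _ _ hf hg => hf.add hg) (isHolAt_const 0 x) hf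

theorem IsHolAt.congr {f g : M → ℂ} {x : M} (hf : IsHolAt f x) (h : f =ᶠ[𝓝 x] g) :
    IsHolAt g x := by
  obtain ⟨U, n, m, D, P, -, hx, -, -, e, he⟩ := exists_chart x
  obtain ⟨G, hG, hfG⟩ := (he f ⟨x, hx⟩).1 hf
  refine (he g ⟨x, hx⟩).2 ⟨G, hG, ?_⟩
  filter_upwards [hfG, continuous_subtype_val.continuousAt.eventually h] with z hz hz'
  rw [← hz, hz']

theorem IsHolAt.continuousAt {f : M → ℂ} {x : M} (hf : IsHolAt f x) : ContinuousAt f x := by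
  obtain ⟨U, n, m, D, P, hU, hx, -, -, e, he⟩ := exists_chart x
  obtain ⟨G, hG, hfG⟩ := (he f ⟨x, hx⟩).1 hf
  have h1 : ContinuousAt (fun z : U => G (e z)) ⟨x, hx⟩ :=
    ContinuousAt.comp' (f := fun z : U => (e z : Fin n → ℂ)) hG.continuousAt
      (continuous_subtype_val.comp e.continuous).continuousAt
  have h2 : ContinuousAt (fun z : U => f z) ⟨x, hx⟩ :=
    h1.congr (by filter_upwards [hfG] with z hz using hz.symm)
  exact (hU.isOpenEmbedding_subtypeVal.continuousAt_iff (g := f) (x := ⟨x, hx⟩)).1 h2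

theorem IsHolAt.eventually {f : M → ℂ} {x : M} (hf : IsHolAt f x) :
    ∀ᶠ y in 𝓝 x, IsHolAt f y := by
  obtain ⟨U, n, m, D, P, hU, hx, -, -, e, he⟩ := exists_chart x
  obtain ⟨G, hG, hfG⟩ := (he f ⟨x, hx⟩).1 hf
  have h1 : ∀ᶠ z : U in 𝓝 ⟨x, hx⟩, AnalyticAt ℂ G (e z) :=
    (continuous_subtype_val.comp e.continuous).continuousAt.eventually
      (f := fun z : U => (e z : Fin n → ℂ)) hG.eventually_analyticAt
  have h2 : ∀ᶠ z : U in 𝓝 ⟨x, hx⟩, IsHolAt f z := by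
    filter_upwards [h1, hfG.eventually_nhds] with z hz hz'
    exact (he f z).2 ⟨G, hz, hz'⟩
  rw [nhds_subtype_eq_comap, eventually_comap] at h2
  filter_upwards [h2, hU.mem_nhds hx] with z hz hzU using hz ⟨z, hzU⟩ rfl

theorem exists_isHolAt_separating (x : M) : ∃ (U : Set M) (n : ℕ) (g : Fin n → M → ℂ),
    IsOpen U ∧ x ∈ U ∧ (∀ i, ∀ y ∈ U, IsHolAt (g i) y) ∧
      ∀ y ∈ U, ∀ z ∈ U, (∀ i, g i y = g i z) → y = z := by
  classical
  obtain ⟨U, n, m, D, P, hU, hx, -, -, e, he⟩ := exists_chart x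
  let g : Fin n → M → ℂ := fun i y => if h : y ∈ U then (e ⟨y, h⟩ : Fin n → ℂ) i else 0
  have hg : ∀ i (y : U), g i y = (e y : Fin n → ℂ) i := fun i y => dif_pos y.2
  refine ⟨U, n, g, hU, hx, fun i y hy => ?_, fun y hy z hz hyz => ?_⟩
  · exact (he (g i) ⟨y, hy⟩).2 ⟨fun z => z i, analyticAt_coord i _, Eventually.of_forall (hg i)⟩
  · have heq : e ⟨y, hy⟩ = e ⟨z, hz⟩ := Subtype.ext (funext fun i => by
      rw [← hg i ⟨y, hy⟩, ← hg i ⟨z, hz⟩, hyz i])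
    exact congrArg Subtype.val (e.injective heq)

end ReducedComplexSpace
namespace IsHolSeriesAt

open ReducedComplexSpace

variable {M : Type u} [TopologicalSpace M] [ReducedComplexSpace M] {S T : M → Cb} {x : M}

theorem const (s : Cb) (x : M) : IsHolSeriesAt (fun _ : M => s) x :=
  Eventually.of_forall fun _ _ => isHolAt_const _ _

theorem of_cst {f : M → ℂ} (hf : IsHolAt f x) : IsHolSeriesAt (fun y => cst (f y)) x := by
  filter_upwards [hf.eventually] with z hz n
  simp only [cst, PowerSeries.coeff_C]
  split_ifs
  · exact hz
  · exact isHolAt_const _ _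

theorem add (hS : IsHolSeriesAt S x) (hT : IsHolSeriesAt T x) :
    IsHolSeriesAt (fun y => S y + T y) x := by
  filter_upwards [hS, hT] with z hz hz' n
  simpa only [map_add] using (hz n).add (hz' n)

theorem mul (hS : IsHolSeriesAt S x) (hT : IsHolSeriesAt T x) :
    IsHolSeriesAt (fun y => S y * T y) x := by
  filter_upwards [hS, hT] with z hz hz' n
  simp only [PowerSeries.coeff_mul]
  exact isHolAt_sum _ fun p _ => (hz p.1).mul (hz' p.2)

theorem neg (hS : IsHolSeriesAt S x) : IsHolSeriesAt (fun y => -S y) x := by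
  filter_upwards [hS] with z hz n
  simpa only [map_neg] using (hz n).neg

theorem sub (hS : IsHolSeriesAt S x) (hT : IsHolSeriesAt T x) :
    IsHolSeriesAt (fun y => S y - T y) x := by
  simpa only [sub_eq_add_neg] using hS.add hT.neg

theorem sum {ι : Type*} (s : Finset ι) {f : ι → M → Cb}
    (hf : ∀ i ∈ s, IsHolSeriesAt (f i) x) : IsHolSeriesAt (fun y => ∑ i ∈ s, f i y) x := by
  simpa only [← Finset.sum_apply] using Finset.sum_induction f (IsHolSeriesAt · x)
    (fun _ _ hf hg => hf.add hg) (const 0 x) hf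

theorem prod {ι : Type*} (s : Finset ι) {f : ι → M → Cb}
    (hf : ∀ i ∈ s, IsHolSeriesAt (f i) x) : IsHolSeriesAt (fun y => ∏ i ∈ s, f i y) x := by
  simpa only [← Finset.prod_apply] using Finset.prod_induction f (IsHolSeriesAt · x)
    (fun _ _ hf hg => hf.mul hg) (const 1 x) hf

theorem deriv (hS : IsHolSeriesAt S x) : IsHolSeriesAt (fun y => bDeriv (S y)) x := by
  filter_upwards [hS] with z hz n
  simp only [bDeriv, PowerSeries.coeff_derivative]
  exact (hz (n + 1)).mul (isHolAt_const _ _)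

theorem congr (hS : IsHolSeriesAt S x) (h : S =ᶠ[𝓝 x] T) : IsHolSeriesAt T x := by
  filter_upwards [hS, h.eventually_nhds] with z hz hz' n
  refine (hz n).congr ?_
  filter_upwards [hz'] with y hy using by rw [hy]

theorem coeff (hS : IsHolSeriesAt S x) (n : ℕ) :
    IsHolAt (fun y => PowerSeries.coeff n (S y)) x :=
  hS.self_of_nhds n

theorem of_X_pow_mul {k : ℕ} (hS : IsHolSeriesAt (fun y => PowerSeries.X ^ k * S y) x) :
    IsHolSeriesAt S x := by
  filter_upwards [hS] with z hz n
  simpa only [PowerSeries.coeff_X_pow_mul] using hz (n + k)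

theorem eventually_constantCoeff_ne_zero (hS : IsHolSeriesAt S x)
    (h0 : PowerSeries.constantCoeff (S x) ≠ 0) :
    ∀ᶠ y in 𝓝 x, PowerSeries.constantCoeff (S y) ≠ 0 := by
  simp only [← PowerSeries.coeff_zero_eq_constantCoeff_apply] at h0 ⊢
  exact (hS.coeff 0).continuousAt.eventually_ne h0

theorem inv (hS : IsHolSeriesAt S x) (h0 : PowerSeries.constantCoeff (S x) ≠ 0) :
    IsHolSeriesAt (fun y => (S y)⁻¹) x := by
  filter_upwards [hS, hS.eventually_constantCoeff_ne_zero h0] with z hz hz0 n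
  have hinv : IsHolAt (fun y => (PowerSeries.constantCoeff (S y))⁻¹) z := by
    simp only [← PowerSeries.coeff_zero_eq_constantCoeff_apply] at hz0 ⊢
    exact (hz 0).inv hz0
  induction n using Nat.strong_induction_on with
  | _ n ih =>
    simp only [fun y => PowerSeries.coeff_inv n (S y)]
    split_ifs with hn
    · exact hinv
    · refine hinv.neg.mul (isHolAt_sum _ fun p _ => ?_)
      split_ifs with hp
      · exact (hz _).mul (ih _ hp)
      · exact isHolAt_const _ _

section Matrix

variable {ι : Type*} [Fintype ι] {A : M → Matrix ι ι Cb} {t : M → ι → Cb}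

theorem mulVec (hA : ∀ i j, IsHolSeriesAt (fun y => A y i j) x)
    (ht : ∀ i, IsHolSeriesAt (fun y => t y i) x) (i : ι) :
    IsHolSeriesAt (fun y => (A y).mulVec (t y) i) x :=
  sum _ fun j _ => (hA i j).mul (ht j)

variable [DecidableEq ι]

theorem det (hA : ∀ i j, IsHolSeriesAt (fun y => A y i j) x) :
    IsHolSeriesAt (fun y => (A y).det) x := by
  simp only [Matrix.det_apply']
  exact sum _ fun σ _ => (const _ x).mul (prod _ fun i _ => hA _ _)

theorem adjugate (hA : ∀ i j, IsHolSeriesAt (fun y => A y i j) x) (i j : ι) :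
    IsHolSeriesAt (fun y => (A y).adjugate i j) x := by
  simp only [Matrix.adjugate_apply]
  refine det fun k l => ?_
  simp only [Matrix.updateRow_apply]
  split_ifs
  · exact const _ x
  · exact hA k l

theorem mulVec_iff {n : ℕ} {D : M → Cb} (hA : ∀ i j, IsHolSeriesAt (fun y => A y i j) x)
    (hD : IsHolSeriesAt D x) (hdet : ∀ᶠ y in 𝓝 x, (A y).det = PowerSeries.X ^ n * D y)
    (h0 : PowerSeries.constantCoeff (D x) ≠ 0) :
    (∀ i, IsHolSeriesAt (fun y => (A y).mulVec (t y) i) x) ↔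
      ∀ i, IsHolSeriesAt (fun y => t y i) x := by
  refine ⟨fun h i => ?_, mulVec hA⟩
  have hcramer : IsHolSeriesAt (fun y => PowerSeries.X ^ n * (D y * t y i)) x := by
    refine (mulVec (adjugate hA) h i).congr ?_
    filter_upwards [hdet] with y hy
    rw [Matrix.mulVec_mulVec, Matrix.adjugate_mul, hy, Matrix.smul_mulVec, Matrix.one_mulVec,
      Pi.smul_apply, smul_eq_mul, mul_assoc]
  refine ((hD.inv h0).mul hcramer.of_X_pow_mul).congr ?_
  filter_upwards [hD.eventually_constantCoeff_ne_zero h0] with y hy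
  rw [← mul_assoc, PowerSeries.inv_mul_cancel _ hy, one_mul]

end Matrix

end IsHolSeriesAt

section ABLinear

variable {E F G : Type*} [AddCommGroup E] [Module Cb E] [ABModule E]
  [AddCommGroup F] [Module Cb F] [ABModule F] [AddCommGroup G] [Module Cb G] [ABModule G]

theorem aPow_succ (j : ℕ) (v : E) : aPow (j + 1) v = ABModule.a (aPow j v) :=
  Function.iterate_succ_apply' _ _ _

/-- `c` is a cyclic vector: `c, a c, …, a^{k-1} c` is a basis. -/
def IsCyclicVector (k : ℕ) (c : E) : Prop :=
  LinearIndependent Cb (fun j : Fin k => aPow j c) ∧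
    Submodule.span Cb (Set.range fun j : Fin k => aPow j c) = ⊤

theorem IsABLinear.comp {θ : E →ₗ[Cb] F} {η : F →ₗ[Cb] G} (hθ : IsABLinear θ)
    (hη : IsABLinear η) : IsABLinear (η ∘ₗ θ) := fun v => by
  rw [LinearMap.comp_apply, hθ v, hη (θ v), LinearMap.comp_apply]

theorem IsABLinear.symm {θ : E ≃ₗ[Cb] F} (hθ : IsABLinear (θ : E →ₗ[Cb] F)) :
    IsABLinear (θ.symm : F →ₗ[Cb] E) := fun v => θ.injective <| by
  simpa using (hθ (θ.symm v)).symm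

theorem IsABLinear.map_aPow {θ : E →ₗ[Cb] F} (hθ : IsABLinear θ) (j : ℕ) (v : E) :
    θ (aPow j v) = aPow j (θ v) := by
  induction j with
  | zero => rfl
  | succ n ih => rw [aPow_succ, hθ, ih, aPow_succ]

theorem IsABLinear.map_sum_smul_aPow {θ : E →ₗ[Cb] F} (hθ : IsABLinear θ) {k : ℕ}
    (g : Fin k → Cb) (c : E) : θ (∑ j, g j • aPow j c) = ∑ j, g j • aPow j (θ c) := by
  simp only [map_sum, map_smul, hθ.map_aPow]

theorem IsABLinear.range_eq_span_aPow {θ : E →ₗ[Cb] F} (hθ : IsABLinear θ) {ι : Type*}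
    {p : ι → ℕ} {c : E} (hc : Submodule.span Cb (Set.range fun i => aPow (p i) c) = ⊤) :
    LinearMap.range θ = Submodule.span Cb (Set.range fun i => aPow (p i) (θ c)) := by
  rw [LinearMap.range_eq_map, ← hc, Submodule.map_span, ← Set.range_comp]
  simp only [Function.comp_def, hθ.map_aPow]

theorem IsCyclicVector.span_aPow_eq_top {k : ℕ} {c : E} (hc : IsCyclicVector k c) :
    Submodule.span Cb (Set.range fun j : ℕ => aPow j c) = ⊤ := by
  rw [eq_top_iff, ← hc.2]
  exact Submodule.span_mono (Set.range_comp_subset_range (fun j : Fin k => (j : ℕ)) (aPow · c))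

theorem IsABLinear.isCyclicVector_of_range_eq {θ : E →ₗ[Cb] F} (hθ : IsABLinear θ)
    (hinj : Function.Injective θ) {k : ℕ} {c : E}
    (hli : LinearIndependent Cb fun j : Fin k => aPow j (θ c))
    (hrange : LinearMap.range θ = Submodule.span Cb (Set.range fun j : Fin k => aPow j (θ c))) :
    IsCyclicVector k c := by
  simp only [← hθ.map_aPow] at hli hrange
  refine ⟨hli.of_comp θ, Submodule.map_injective_of_injective hinj ?_⟩
  rw [← LinearMap.range_eq_map, hrange, Submodule.map_span, ← Set.range_comp]
  rfl

theorem ABIsomorphic.symm (h : ABIsomorphic E F) : ABIsomorphic F E := by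
  obtain ⟨θ, hθ, hbij⟩ := h
  exact ⟨_, IsABLinear.symm (θ := .ofBijective θ hbij) hθ, LinearEquiv.bijective _⟩

theorem ABIsomorphic.trans (h : ABIsomorphic E F) (h' : ABIsomorphic F G) : ABIsomorphic E G := by
  obtain ⟨θ, hθ, hbij⟩ := h
  obtain ⟨η, hη, hbij'⟩ := h'
  exact ⟨η ∘ₗ θ, hθ.comp hη, hbij'.comp hbij⟩

theorem exists_bijective_lift_of_range_eq {ι : E →ₗ[Cb] G} {θ : F →ₗ[Cb] G} (hι : IsABLinear ι)
    (hθ : IsABLinear θ) (hιinj : Function.Injective ι) (hθinj : Function.Injective θ)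
    (hrange : LinearMap.range ι = LinearMap.range θ) :
    ∃ ψ : E →ₗ[Cb] F, IsABLinear ψ ∧ Function.Bijective ψ ∧ ∀ x, θ (ψ x) = ι x := by
  let ψ : E ≃ₗ[Cb] F := LinearEquiv.ofInjective ι hιinj ≪≫ₗ LinearEquiv.ofEq _ _ hrange ≪≫ₗ
    (LinearEquiv.ofInjective θ hθinj).symm
  have hψ : ∀ x, θ (ψ x) = ι x := fun x =>
    congrArg Subtype.val ((LinearEquiv.ofInjective θ hθinj).apply_symm_apply _)
  refine ⟨ψ, fun v => hθinj ?_, ψ.bijective, hψ⟩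
  rw [hθ]
  simp only [LinearEquiv.coe_coe, hψ, hι v]

end ABLinear

section Connection

variable {m n : Type*} [Fintype m] [Fintype n]

/-- The operator `a` on column vectors, when it acts on the basis through the matrix `A`. -/
noncomputable def connection (A : Matrix n n Cb) (x : n → Cb) : n → Cb :=
  A.mulVec x + fun i => bVar ^ 2 * bDeriv (x i)

/-- The matrix `P` commutes with the connections of matrices `A` and `B`. -/
def Intertwines (A : Matrix n n Cb) (B : Matrix m m Cb) (P : Matrix m n Cb) : Prop :=
  P * A = B * P + bVar ^ 2 • P.map bDeriv

theorem constantCoeff_connection (A : Matrix n n Cb) (x : n → Cb) (i : n) :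
    PowerSeries.constantCoeff (connection A x i)
      = ∑ j, PowerSeries.constantCoeff (A i j) * PowerSeries.constantCoeff (x j) := by
  simp [connection, Matrix.mulVec, dotProduct]

theorem Intertwines.mulVec_connection {A : Matrix n n Cb} {B : Matrix m m Cb} {P : Matrix m n Cb}
    (h : Intertwines A B P) (x : n → Cb) :
    P.mulVec (connection A x) = connection B (P.mulVec x) := by
  have hleibniz : (fun i => bVar ^ 2 * bDeriv (P.mulVec x i))
      = (bVar ^ 2 • P.map bDeriv).mulVec x + P.mulVec fun i => bVar ^ 2 * bDeriv (x i) := by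
    funext i
    simp only [Matrix.mulVec, dotProduct, Pi.add_apply, map_sum, Derivation.leibniz, smul_eq_mul,
      Matrix.smul_apply, Matrix.map_apply, Finset.mul_sum, ← Finset.sum_add_distrib]
    exact Finset.sum_congr rfl fun j _ => by ring
  rw [connection, connection, hleibniz, Matrix.mulVec_add, Matrix.mulVec_mulVec,
    Matrix.mulVec_mulVec, h, Matrix.add_mulVec, add_assoc]

theorem connection_single [DecidableEq n] (A : Matrix n n Cb) (j : n) :
    connection A (Pi.single j 1) = A.col j := by
  funext i
  obtain rfl | hij := eq_or_ne i j
  · simp [connection]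
  · simp [connection, hij]

theorem intertwines_iff {A : Matrix n n Cb} {B : Matrix m m Cb} {P : Matrix m n Cb} :
    Intertwines A B P ↔ ∀ x, P.mulVec (connection A x) = connection B (P.mulVec x) := by
  classical
  refine ⟨Intertwines.mulVec_connection, fun h => Matrix.ext fun i j => ?_⟩
  have hj := congrFun (h (Pi.single j 1)) i
  rwa [connection_single, Matrix.mulVec_single_one] at hj

variable {E : Type*} [AddCommGroup E] [Module Cb E] [ABModule E]

/-- `A` is the matrix of `a` in the basis `e`. -/
def HasConnectionMatrix (e : Module.Basis n Cb E) (A : Matrix n n Cb) : Prop :=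
  ∀ j, ABModule.a (e j) = ∑ i, A i j • e i

variable {e : Module.Basis n Cb E} {A : Matrix n n Cb}

theorem HasConnectionMatrix.repr_a (h : HasConnectionMatrix e A) (v : E) :
    ⇑(e.repr (ABModule.a v)) = connection A (e.repr v) := by
  have hsum : ABModule.a v = ∑ i, connection A (e.repr v) i • e i := by
    conv_lhs => rw [← e.sum_repr v, map_sum]
    simp only [ABModule.a_smul, h _, connection, Matrix.mulVec, dotProduct, Pi.add_apply, add_smul,
      Finset.sum_add_distrib, Finset.smul_sum, Finset.sum_smul, smul_smul, mul_comm (A _ _)]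
    rw [Finset.sum_comm]
  rw [hsum, e.repr_sum_self]

theorem HasConnectionMatrix.intertwines_toMatrix [DecidableEq n] (h : HasConnectionMatrix e A)
    {B : Matrix m m Cb} {q : E →ₗ[Cb] m → Cb}
    (hq : ∀ v, q (ABModule.a v) = connection B (q v)) :
    Intertwines A B (LinearMap.toMatrix e (Pi.basisFun Cb m) q) := by
  have hmul : ∀ v, (LinearMap.toMatrix e (Pi.basisFun Cb m) q).mulVec (e.repr v) = q v :=
    LinearMap.toMatrix_mulVec_repr e (Pi.basisFun Cb m) q
  refine intertwines_iff.2 fun x => ?_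
  obtain ⟨v, rfl⟩ : ∃ v, ⇑(e.repr v) = x := ⟨e.equivFun.symm x, e.equivFun.apply_symm_apply x⟩
  rw [← h.repr_a, hmul, hmul, hq]

end Connection

/-- The matrix of `a` in a basis adapted to a filtration with rank one quotients of invariant
`lam`. -/
noncomputable def triangularMatrix (lam : ℚ) (S T U : Cb) : Matrix (Fin 3) (Fin 3) Cb :=
  !![cst (lam : ℂ) * bVar, S, U;
     0, cst (lam : ℂ) * bVar, T;
     0, 0, cst (lam : ℂ) * bVar]

section Triangular

variable {E : Type*} [AddCommGroup E] [Module Cb E] [ABModule E] {lam : ℚ} {S T U : Cb}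
  {e : Module.Basis (Fin 3) Cb E}

theorem constantCoeff_det_aPow (he : HasConnectionMatrix e (triangularMatrix lam S T U)) (c : E) :
    PowerSeries.constantCoeff (e.det fun j : Fin 3 => aPow j c)
      = -(PowerSeries.constantCoeff S * PowerSeries.constantCoeff T ^ 2
          * PowerSeries.constantCoeff (e.repr c 2) ^ 3) := by
  have hcol : ∀ v i, PowerSeries.constantCoeff (e.repr (ABModule.a v) i)
      = PowerSeries.constantCoeff (connection (triangularMatrix lam S T U) (e.repr v) i) :=
    fun v i => congrArg _ (congrFun (he.repr_a v) i)
  simp [Module.Basis.det_apply, Matrix.det_fin_three, Module.Basis.toMatrix_apply, aPow_succ,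
    hcol, constantCoeff_connection, Fin.sum_univ_three, triangularMatrix,
    show aPow 0 c = c from rfl]
  ring

theorem isCyclicVector_iff_isUnit_det {k : ℕ} (e : Module.Basis (Fin k) Cb E) (c : E) :
    IsCyclicVector k c ↔ IsUnit (e.det fun j : Fin k => aPow j c) :=
  e.is_basis_iff_det

theorem isCyclicVector_iff (he : HasConnectionMatrix e (triangularMatrix lam S T U)) (c : E) :
    IsCyclicVector 3 c ↔ PowerSeries.constantCoeff S ≠ 0 ∧ PowerSeries.constantCoeff T ≠ 0 ∧
      PowerSeries.constantCoeff (e.repr c 2) ≠ 0 := by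
  rw [isCyclicVector_iff_isUnit_det e, PowerSeries.isUnit_iff_constantCoeff,
    constantCoeff_det_aPow he, isUnit_iff_ne_zero]
  simp only [ne_eq, neg_eq_zero, mul_eq_zero, not_or, pow_eq_zero_iff, OfNat.ofNat_ne_zero,
    not_false_iff, and_assoc]

theorem exists_triangular_basis
    (h : HasFundamentalInvariants (fun _ : Fin 3 => lam) E) :
    ∃ (e : Module.Basis (Fin 3) Cb E) (S T U : Cb),
      HasConnectionMatrix e (triangularMatrix lam S T U) := by
  obtain ⟨e, he⟩ := h
  have hlt : e '' {i | i < 0} = ∅ ∧ e '' {i | i < 1} = {e 0} ∧ e '' {i | i < 2} = {e 0, e 1} := by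
    refine ⟨?_, ?_, ?_⟩ <;> ext v <;> simp [Fin.exists_fin_succ, Fin.lt_def, eq_comm]
  obtain ⟨h0, h1, h2⟩ := hlt
  have e0 := he 0
  have e1 := he 1
  have e2 := he 2
  rw [h0, Submodule.span_empty, Submodule.mem_bot, sub_eq_zero] at e0
  rw [h1, Submodule.mem_span_singleton] at e1
  rw [h2, Submodule.mem_span_pair] at e2
  obtain ⟨S, hS⟩ := e1
  obtain ⟨U, T, hT⟩ := e2
  refine ⟨e, S, T, U, fun j => ?_⟩
  fin_cases j
  · simpa [Fin.sum_univ_three, triangularMatrix] using e0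
  · simp [Fin.sum_univ_three, triangularMatrix, hS]
  · simp [Fin.sum_univ_three, triangularMatrix, hT]

end Triangular

section Hom

theorem eq_cst_of_X_sq_mul_deriv_eq_zero {s : Cb} (h : bVar ^ 2 * bDeriv s = 0) :
    s = cst (PowerSeries.constantCoeff s) := by
  have hs : bDeriv s = 0 :=
    (mul_eq_zero.1 h).resolve_left (pow_ne_zero 2 PowerSeries.X_ne_zero)
  exact PowerSeries.derivative.ext (by simpa using hs) (by simp)

theorem eq_of_X_sq_mul_deriv_eq {s : Cb} {p q d : ℂ}
    (h : bVar ^ 2 * bDeriv s = cst p + cst q * bVar + bVar ^ 2 * cst d) :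
    p = 0 ∧ q = 0 ∧ s = cst (PowerSeries.constantCoeff s) + cst d * bVar := by
  have hp : p = 0 := by simpa using (congrArg (PowerSeries.coeff 0) h).symm
  have hq : q = 0 := by
    simpa [PowerSeries.coeff_X_pow_mul', PowerSeries.coeff_C, hp] using
      (congrArg (PowerSeries.coeff 1) h).symm
  subst hp hq
  refine ⟨rfl, rfl, ?_⟩
  have hs : bDeriv s = cst d :=
    mul_left_cancel₀ (pow_ne_zero 2 PowerSeries.X_ne_zero) (by simpa using h)
  exact PowerSeries.derivative.ext (by simpa [Derivation.leibniz] using hs) (by simp)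

theorem Intertwines.triangularMatrix_entries {lam : ℚ} {S T U S' T' U' : Cb}
    {P : Matrix (Fin 3) (Fin 3) Cb}
    (h : Intertwines (triangularMatrix lam S T U) (triangularMatrix lam S' T' U') P) :
    (0 = S' * P 1 0 + U' * P 2 0 + bVar ^ 2 * bDeriv (P 0 0) ∧
      0 = T' * P 2 0 + bVar ^ 2 * bDeriv (P 1 0) ∧ 0 = bVar ^ 2 * bDeriv (P 2 0)) ∧
    (P 0 0 * S = S' * P 1 1 + U' * P 2 1 + bVar ^ 2 * bDeriv (P 0 1) ∧
      P 1 0 * S = T' * P 2 1 + bVar ^ 2 * bDeriv (P 1 1) ∧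
      P 2 0 * S = bVar ^ 2 * bDeriv (P 2 1)) ∧
    P 0 0 * U + P 0 1 * T = S' * P 1 2 + U' * P 2 2 + bVar ^ 2 * bDeriv (P 0 2) ∧
      P 1 0 * U + P 1 1 * T = T' * P 2 2 + bVar ^ 2 * bDeriv (P 1 2) ∧
      P 2 0 * U + P 2 1 * T = bVar ^ 2 * bDeriv (P 2 2) := by
  have hent : ∀ j i, (P * triangularMatrix lam S T U) i j
      = (triangularMatrix lam S' T' U' * P + bVar ^ 2 • P.map bDeriv) i j :=
    fun j i => congrFun (congrFun h i) j
  simp only [Matrix.mul_apply, Fin.sum_univ_three, triangularMatrix, Matrix.add_apply,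
    Matrix.smul_apply, Matrix.map_apply, smul_eq_mul, Fin.forall_fin_succ, Matrix.of_apply,
    Matrix.cons_val_zero, Matrix.cons_val_one, Matrix.cons_val, Fin.succ_zero_eq_one,
    Fin.succ_one_eq_two, IsEmpty.forall_iff, and_true, mul_zero, zero_mul, zero_add,
    add_zero] at hent
  obtain ⟨⟨h00, h10, h20⟩, ⟨h01, h11, h21⟩, h02, h12, h22⟩ := hent
  exact ⟨⟨by linear_combination h00, by linear_combination h10, by linear_combination h20⟩,
    ⟨by linear_combination h01, by linear_combination h11, by linear_combination h21⟩,
    by linear_combination h02, by linear_combination h12, by linear_combination h22⟩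

theorem eq_zero_of_mul_add_eq_zero_of_deriv_eq_zero {R p q : Cb}
    (hR : PowerSeries.constantCoeff R ≠ 0) (hp : 0 = bVar ^ 2 * bDeriv p)
    (h : 0 = R * p + bVar ^ 2 * bDeriv q) : p = 0 := by
  have hcst := eq_cst_of_X_sq_mul_deriv_eq_zero hp.symm
  have hp0 : PowerSeries.constantCoeff p = 0 := by
    simpa [hR] using congrArg PowerSeries.constantCoeff h
  rw [hcst, hp0]
  exact map_zero _

theorem Intertwines.lower_eq_zero {lam : ℚ} {S T U S' T' U' : Cb}
    {P : Matrix (Fin 3) (Fin 3) Cb}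
    (h : Intertwines (triangularMatrix lam S T U) (triangularMatrix lam S' T' U') P)
    (hS' : PowerSeries.constantCoeff S' ≠ 0) (hT' : PowerSeries.constantCoeff T' ≠ 0) :
    P 1 0 = 0 ∧ P 2 0 = 0 ∧ P 2 1 = 0 := by
  obtain ⟨⟨h00, h10, h20⟩, ⟨-, h11, h21⟩, -⟩ := h.triangularMatrix_entries
  have hP20 : P 2 0 = 0 := eq_zero_of_mul_add_eq_zero_of_deriv_eq_zero hT' h20 h10
  rw [hP20, mul_zero, add_zero] at h00
  rw [hP20, mul_zero, zero_add] at h10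
  rw [hP20, zero_mul] at h21
  have hP10 : P 1 0 = 0 := eq_zero_of_mul_add_eq_zero_of_deriv_eq_zero hS' h10 h00
  rw [hP10, zero_mul] at h11
  exact ⟨hP10, hP20, eq_zero_of_mul_add_eq_zero_of_deriv_eq_zero hT' h21 h11⟩

theorem Intertwines.exists_upperTriangular {lam : ℚ} {S T U S' T' U' : Cb}
    {P : Matrix (Fin 3) (Fin 3) Cb}
    (h : Intertwines (triangularMatrix lam S T U) (triangularMatrix lam S' T' U') P)
    (hS' : PowerSeries.constantCoeff S' ≠ 0) (hT' : PowerSeries.constantCoeff T' ≠ 0) :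
    ∃ (c₀ c₁ c₂ : ℂ) (p q r : Cb), P = !![cst c₀, p, r; 0, cst c₁, q; 0, 0, cst c₂] ∧
      cst c₀ * S = S' * cst c₁ + bVar ^ 2 * bDeriv p ∧
      cst c₁ * T = T' * cst c₂ + bVar ^ 2 * bDeriv q ∧
      cst c₀ * U + p * T = S' * q + U' * cst c₂ + bVar ^ 2 * bDeriv r := by
  obtain ⟨hP10, hP20, hP21⟩ := h.lower_eq_zero hS' hT'
  obtain ⟨⟨h00, -, -⟩, ⟨h01, h11, -⟩, h02, h12, h22⟩ := h.triangularMatrix_entries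
  simp only [hP10, hP20, hP21, zero_mul, mul_zero, zero_add, add_zero] at h00 h01 h11 h12 h22
  obtain ⟨c₀, h₀⟩ : ∃ c, P 0 0 = cst c :=
    ⟨_, eq_cst_of_X_sq_mul_deriv_eq_zero h00.symm⟩
  obtain ⟨c₁, h₁⟩ : ∃ c, P 1 1 = cst c :=
    ⟨_, eq_cst_of_X_sq_mul_deriv_eq_zero h11.symm⟩
  obtain ⟨c₂, h₂⟩ : ∃ c, P 2 2 = cst c :=
    ⟨_, eq_cst_of_X_sq_mul_deriv_eq_zero h22.symm⟩
  rw [h₀, h₁] at h01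
  rw [h₁, h₂] at h12
  rw [h₀, h₂] at h02
  refine ⟨c₀, c₁, c₂, P 0 1, P 1 2, P 0 2, ?_, h01, h12, h02⟩
  rw [← h₀, ← h₁, ← h₂]
  ext i j : 1
  fin_cases i <;> fin_cases j <;> first | rfl | assumption

theorem intertwines_upperTriangular {lam : ℚ} {S T U S' T' U' p q r : Cb} {c₀ c₁ c₂ : ℂ}
    (hp : cst c₀ * S = S' * cst c₁ + bVar ^ 2 * bDeriv p)
    (hq : cst c₁ * T = T' * cst c₂ + bVar ^ 2 * bDeriv q)
    (hr : cst c₀ * U + p * T = S' * q + U' * cst c₂ + bVar ^ 2 * bDeriv r) :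
    Intertwines (triangularMatrix lam S T U) (triangularMatrix lam S' T' U')
      !![cst c₀, p, r; 0, cst c₁, q; 0, 0, cst c₂] := by
  have hderiv : bVar ^ 2 • (!![cst c₀, p, r; 0, cst c₁, q; 0, 0, cst c₂] :
      Matrix (Fin 3) (Fin 3) Cb).map bDeriv =
      !![0, cst c₀ * S - S' * cst c₁, cst c₀ * U + p * T - (S' * q + U' * cst c₂);
        0, 0, cst c₁ * T - T' * cst c₂; 0, 0, 0] := by
    ext i j : 1
    fin_cases i <;> fin_cases j <;> simp [hp, hq, hr]
  rw [Intertwines, hderiv, triangularMatrix, triangularMatrix]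
  ext i j : 1
  fin_cases i <;> fin_cases j <;>
    simp only [Matrix.mul_apply, Fin.sum_univ_three, Matrix.add_apply] <;>
    simp only [Fin.isValue, Fin.zero_eta, Fin.mk_one, Fin.reduceFinMk, Matrix.of_apply,
      Matrix.cons_val', Matrix.cons_val_zero, Matrix.cons_val_fin_one, Matrix.cons_val_one,
      Matrix.cons_val] <;> ring

end Hom

/-- The matrix of `a` in the basis `e₁, e₂, e₃` of `E(α,β,γ)`. -/
noncomputable def canonicalMatrix (lam : ℚ) (α β γ : ℂ) : Matrix (Fin 3) (Fin 3) Cb :=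
  triangularMatrix lam (1 + cst β * bVar + cst γ * bVar ^ 2) (1 + cst α * bVar) 0

theorem canonicalA_eq_connection (lam : ℚ) (α β γ : ℂ) (x : Fin 3 → Cb) :
    canonicalA lam α β γ x = connection (canonicalMatrix lam α β γ) x := by
  funext i
  fin_cases i <;>
    simp [canonicalA, connection, canonicalMatrix, triangularMatrix, dotProduct, Fin.sum_univ_three,
      add_right_comm]

/-- The basis `e₁, e₂, e₃` of `E(α,β,γ)`. -/
noncomputable def themeBasis (lam : ℚ) (α β γ : ℂ) :
    Module.Basis (Fin 3) Cb (CanonicalTheme lam α β γ) := Pi.basisFun Cb (Fin 3)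

theorem themeBasis_repr {lam : ℚ} {α β γ : ℂ} (v : CanonicalTheme lam α β γ) :
    ⇑((themeBasis lam α β γ).repr v) = v := rfl

theorem hasConnectionMatrix_themeBasis (lam : ℚ) (α β γ : ℂ) :
    HasConnectionMatrix (themeBasis lam α β γ) (canonicalMatrix lam α β γ) := fun j => by
  have hcol : canonicalA lam α β γ (Pi.single j 1) = (canonicalMatrix lam α β γ).col j := by
    rw [canonicalA_eq_connection, connection_single]
  have hsingle : themeBasis lam α β γ j = (Pi.single j 1 : Fin 3 → Cb) := Pi.basisFun_apply _ _ _
  refine (themeBasis lam α β γ).ext_elem fun i => ?_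
  rw [Module.Basis.repr_sum_self, hsingle]
  exact congrFun hcol i

theorem finrank_canonicalTheme (lam : ℚ) (α β γ : ℂ) :
    Module.finrank Cb (CanonicalTheme lam α β γ) = 3 := by
  rw [Module.finrank_eq_card_basis (themeBasis lam α β γ), Fintype.card_fin]

section MatrixHom

variable {lam : ℚ} {α β γ α' β' γ' : ℂ} {P : Matrix (Fin 3) (Fin 3) Cb}

/-- The linear map between canonical themes with matrix `P`. -/
noncomputable def matrixHom (P : Matrix (Fin 3) (Fin 3) Cb) :
    CanonicalTheme lam α β γ →ₗ[Cb] CanonicalTheme lam α' β' γ' := P.mulVecLin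

theorem exists_eq_matrixHom (u : CanonicalTheme lam α β γ →ₗ[Cb] CanonicalTheme lam α' β' γ') :
    ∃ P, u = matrixHom P :=
  ⟨LinearMap.toMatrix' (u : (Fin 3 → Cb) →ₗ[Cb] Fin 3 → Cb), (Matrix.toLin'_toMatrix' _).symm⟩

theorem isABLinear_matrixHom_iff :
    IsABLinear (matrixHom P : CanonicalTheme lam α β γ →ₗ[Cb] CanonicalTheme lam α' β' γ') ↔
      Intertwines (canonicalMatrix lam α β γ) (canonicalMatrix lam α' β' γ') P := by
  rw [intertwines_iff]
  have ha : ∀ x : Fin 3 → Cb,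
      P.mulVec (canonicalA lam α β γ x) = canonicalA lam α' β' γ' (P.mulVec x) ↔
        P.mulVec (connection (canonicalMatrix lam α β γ) x)
          = connection (canonicalMatrix lam α' β' γ') (P.mulVec x) := fun x => by
    rw [canonicalA_eq_connection, canonicalA_eq_connection]
  exact forall_congr' ha

theorem matrixHom_bijective_iff :
    Function.Bijective
        (matrixHom P : CanonicalTheme lam α β γ →ₗ[Cb] CanonicalTheme lam α' β' γ') ↔
      IsUnit P.det := by
  rw [← Matrix.isUnit_iff_isUnit_det]
  exact ⟨fun h => Matrix.mulVec_surjective_iff_isUnit.1 h.2, fun h =>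
    ⟨Matrix.mulVec_injective_of_isUnit h, Matrix.mulVec_surjective_iff_isUnit.2 h⟩⟩

theorem finrank_range_matrixHom :
    Module.finrank Cb (LinearMap.range
      (matrixHom P : CanonicalTheme lam α β γ →ₗ[Cb] CanonicalTheme lam α' β' γ')) = P.rank :=
  rfl

/-- The general homomorphism from `E(α,β,γ)` to `E(α',β',γ')`; the parameters `c, k, l` are the
constant terms of the entries. -/
noncomputable def homMatrix (α γ γ' c k l : ℂ) : Matrix (Fin 3) (Fin 3) Cb :=
  !![cst c, cst k + cst ((γ - γ') * c) * bVar,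
      cst l + cst (α * (γ - γ') * c - γ' * k) * bVar;
    0, cst c, cst k;
    0, 0, cst c]

theorem det_homMatrix (α γ γ' c k l : ℂ) : (homMatrix α γ γ' c k l).det = cst (c ^ 3) := by
  simp [homMatrix, Matrix.det_fin_three, pow_three, mul_assoc]

theorem exists_eq_homMatrix_of_intertwines
    (h : Intertwines (canonicalMatrix lam α β γ) (canonicalMatrix lam α' β' γ') P) :
    ∃ c k l : ℂ, β' * c = β * c ∧ α' * c = α * c ∧ (β' - α) * k = (γ - γ') * c ∧
      P = homMatrix α γ γ' c k l := by
  obtain ⟨c, c₁, c₂, p, q, r, rfl, hp', hq', hr'⟩ := h.exists_upperTriangular (by simp) (by simp)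
  obtain ⟨hc₁, hβ, hp⟩ : c - c₁ = 0 ∧ c * β - c₁ * β' = 0 ∧ _ :=
    eq_of_X_sq_mul_deriv_eq (s := p) (d := c * γ - c₁ * γ') (by
      simp only [map_sub, map_mul]; linear_combination -hp')
  obtain rfl : c₁ = c := (sub_eq_zero.1 hc₁).symm
  obtain ⟨hc₂, hα, hq⟩ : c₁ - c₂ = 0 ∧ c₁ * α - c₂ * α' = 0 ∧ _ :=
    eq_of_X_sq_mul_deriv_eq (s := q) (d := 0) (by
      simp only [map_sub, map_mul, map_zero]; linear_combination -hq')
  obtain rfl : c₂ = c₁ := (sub_eq_zero.1 hc₂).symm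
  generalize PowerSeries.constantCoeff p = k at hp
  generalize PowerSeries.constantCoeff q = k' at hq
  obtain ⟨hk', hk, hr⟩ : k - k' = 0 ∧ k * α + (c₂ * γ - c₂ * γ') - k' * β' = 0 ∧ _ :=
    eq_of_X_sq_mul_deriv_eq (s := r) (d := α * (c₂ * γ - c₂ * γ') - γ' * k') (by
      simp only [hp, hq, map_add, map_sub, map_mul, map_zero] at hr' ⊢
      linear_combination -hr')
  generalize PowerSeries.constantCoeff r = l at hr
  obtain rfl : k' = k := (sub_eq_zero.1 hk').symm
  refine ⟨c₂, k', l, by linear_combination -hβ,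
    by linear_combination -hα, by linear_combination -hk, ?_⟩
  simp only [hp, hq, hr, map_zero, zero_mul, add_zero, homMatrix, mul_comm c₂, ← sub_mul, mul_assoc]

theorem intertwines_homMatrix {c k : ℂ} (hβ : β' * c = β * c) (hα : α' * c = α * c)
    (hk : (β' - α) * k = (γ - γ') * c) (l : ℂ) :
    Intertwines (canonicalMatrix lam α β γ) (canonicalMatrix lam α' β' γ')
      (homMatrix α γ γ' c k l) := by
  have hβ' := congrArg cst hβ
  have hα' := congrArg cst hα
  have hk' := congrArg cst hk
  simp only [map_mul, map_sub] at hβ' hα' hk'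
  refine intertwines_upperTriangular ?_ ?_ ?_
  · simp only [map_add, map_mul, map_sub, PowerSeries.derivative_C, Derivation.leibniz,
      PowerSeries.derivative_X, smul_eq_mul]
    linear_combination -hβ' * bVar
  · simp only [PowerSeries.derivative_C]
    linear_combination -hα' * bVar
  · simp only [map_add, map_mul, map_sub, PowerSeries.derivative_C, Derivation.leibniz,
      PowerSeries.derivative_X, smul_eq_mul]
    linear_combination -hk' * bVar

theorem rank_homMatrix_of_ne_zero {k : ℂ} (hk : k ≠ 0) (α γ γ' l : ℂ) :
    (homMatrix α γ γ' 0 k l).rank = 2 := by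
  have hk' : cst k ≠ 0 := (map_ne_zero_iff _ PowerSeries.C_injective).2 hk
  apply le_antisymm
  · have hfactor : homMatrix α γ γ' 0 k l =
        (!![1, 0; 0, 1; 0, 0] : Matrix (Fin 3) (Fin 2) Cb)
        * !![0, cst k, cst l + cst (-(γ' * k)) * bVar; 0, 0, cst k] := by
      ext i j : 1
      fin_cases i <;> fin_cases j <;> simp [homMatrix, Matrix.mul_apply, Fin.sum_univ_two]
    rw [hfactor]
    exact (Matrix.rank_mul_le_left _ _).trans (Matrix.rank_le_width _)
  · have hminor : (homMatrix α γ γ' 0 k l).submatrix ![0, 1] ![1, 2] =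
        !![cst k, cst l + cst (-(γ' * k)) * bVar; 0, cst k] := by
      ext i j : 1
      fin_cases i <;> fin_cases j <;> simp [homMatrix]
    have hdet : ((homMatrix α γ γ' 0 k l).submatrix ![0, 1] ![1, 2]).det ≠ 0 := by
      simp [hminor, Matrix.det_fin_two_of, hk']
    exact (Matrix.rank_of_det_ne_zero hdet).symm.trans_le (Matrix.rank_submatrix_le _ _ _)

theorem rank_homMatrix_zero_zero_le (α γ γ' l : ℂ) : (homMatrix α γ γ' 0 0 l).rank ≤ 1 := by
  have hfactor : homMatrix α γ γ' 0 0 l = Matrix.vecMulVec ![cst l, 0, 0] ![0, 0, 1] := by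
    ext i j : 1
    fin_cases i <;> fin_cases j <;> simp [homMatrix, Matrix.vecMulVec_apply]
  rw [hfactor]
  exact Matrix.rank_vecMulVec_le _ _

end MatrixHom

section CanonicalTheme

variable {lam : ℚ} {α β : ℂ}

theorem eq_of_abIsomorphic {γ α' β' γ' : ℂ}
    (h : ABIsomorphic (CanonicalTheme lam α β γ) (CanonicalTheme lam α' β' γ')) :
    α' = α ∧ β' = β ∧ (α = β → γ' = γ) := by
  obtain ⟨u, hu, hbij⟩ := h
  obtain ⟨P, rfl⟩ := exists_eq_matrixHom u
  obtain ⟨c, k, l, hβ, hα, hk, rfl⟩ :=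
    exists_eq_homMatrix_of_intertwines (isABLinear_matrixHom_iff.1 hu)
  have hc : c ≠ 0 := by
    simpa [det_homMatrix, PowerSeries.isUnit_iff_constantCoeff] using
      matrixHom_bijective_iff.1 hbij
  obtain rfl : β' = β := mul_right_cancel₀ hc hβ
  refine ⟨mul_right_cancel₀ hc hα, rfl, ?_⟩
  rintro rfl
  rw [sub_self, zero_mul, zero_eq_mul] at hk
  exact (sub_eq_zero.1 (hk.resolve_right hc)).symm

theorem not_isInvariantTheme (hαβ : α ≠ β) (γ : ℂ) :
    ¬ IsInvariantTheme (CanonicalTheme lam α β γ) := by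
  rintro ⟨u, hu, hrank⟩
  obtain ⟨P, rfl⟩ := exists_eq_matrixHom u
  obtain ⟨c, k, l, -, -, hk, rfl⟩ :=
    exists_eq_homMatrix_of_intertwines (isABLinear_matrixHom_iff.1 hu)
  rw [finrank_range_matrixHom, finrank_canonicalTheme] at hrank
  obtain rfl : k = 0 := by simpa [sub_eq_zero, hαβ.symm] using hk
  rcases eq_or_ne c 0 with rfl | hc
  · have := rank_homMatrix_zero_zero_le α γ γ l
    omega
  · have hunit : IsUnit (homMatrix α γ γ c 0 l) := by
      simp [Matrix.isUnit_iff_isUnit_det, det_homMatrix, hc]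
    rw [Matrix.rank_of_isUnit _ hunit, Fintype.card_fin] at hrank
    omega

theorem isInvariantTheme_canonicalTheme (hα : α ≠ 0) (γ : ℂ) :
    IsInvariantTheme (CanonicalTheme lam α α γ) := by
  refine ⟨matrixHom (homMatrix α γ γ 0 α 0), isABLinear_matrixHom_iff.2
    (intertwines_homMatrix (by simp) (by simp) (by simp) _), ?_⟩
  rw [finrank_range_matrixHom, finrank_canonicalTheme, rank_homMatrix_of_ne_zero hα]

/-- The isomorphism from `E(α,β,γ)` to `E(α',β',γ')` sending `e₃` to `e₃ + x e₂ + ⋯`, for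
`α' = α` and `β' = β`. The parameters of the target are kept apart because, in families, they are
given by other functions. -/
noncomputable def shearMap (lam : ℚ) (α β γ α' β' γ' x : ℂ) :
    CanonicalTheme lam α β γ →ₗ[Cb] CanonicalTheme lam α' β' γ' :=
  matrixHom (homMatrix α γ γ' 1 x 0)

theorem isABLinear_shearMap {γ γ' x : ℂ} (hα : α' = α) (hβ : β' = β)
    (hx : x * (β - α) = γ - γ') : IsABLinear (shearMap lam α β γ α' β' γ' x) := by
  subst hα hβ
  exact isABLinear_matrixHom_iff.2
    (intertwines_homMatrix rfl rfl (by rw [mul_one, ← hx, mul_comm]) _)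

theorem shearMap_bijective (lam : ℚ) (α β γ α' β' γ' x : ℂ) :
    Function.Bijective (shearMap lam α β γ α' β' γ' x) :=
  matrixHom_bijective_iff.2 (by simp [det_homMatrix])

theorem abIsomorphic_canonicalTheme (hαβ : α ≠ β) (γ γ' : ℂ) :
    ABIsomorphic (CanonicalTheme lam α β γ) (CanonicalTheme lam α β γ') :=
  ⟨shearMap lam α β γ α β γ' ((γ - γ') / (β - α)),
    isABLinear_shearMap rfl rfl (div_mul_cancel₀ _ (sub_ne_zero.2 hαβ.symm)),
    shearMap_bijective lam α β γ α β γ' _⟩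

end CanonicalTheme

section Embedding

theorem HasConnectionMatrix.hasFundamentalInvariants {E : Type*} [AddCommGroup E] [Module Cb E]
    [ABModule E] {lam : ℚ} {S T U : Cb} {e : Module.Basis (Fin 3) Cb E}
    (he : HasConnectionMatrix e (triangularMatrix lam S T U)) :
    HasFundamentalInvariants (fun _ : Fin 3 => lam) E := by
  refine ⟨e, fun j => ?_⟩
  have hmem : ∀ i < j, ∀ c : Cb, c • e i ∈ Submodule.span Cb (e '' {i | i < j}) :=
    fun i hi c => Submodule.smul_mem _ _ (Submodule.subset_span ⟨i, hi, rfl⟩)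
  rw [he, Fin.sum_univ_three]
  fin_cases j
  · simp [triangularMatrix]
  · simpa [triangularMatrix] using hmem 0 (by simp) S
  · simpa [triangularMatrix] using
      add_mem (hmem 0 (by simp) U) (hmem 1 (by simp [Fin.lt_def]) T)

theorem xi_a_apply {Λ : Finset ℚ} (x : Xi Λ 2) (ν : Λ) :
    (ABModule.a x : Xi Λ 2) ν = connection (triangularMatrix ν bVar bVar 0) (x ν) := by
  funext i
  change cst ((ν : ℚ) : ℂ) * bVar * x ν i + bVar ^ 2 * bDeriv (x ν i)
    + (if h : (i : ℕ) + 1 < 2 + 1 then bVar * x ν ⟨(i : ℕ) + 1, h⟩ else 0) = _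
  fin_cases i <;>
    simp [connection, triangularMatrix, dotProduct, Fin.sum_univ_three, add_right_comm]

theorem Intertwines.X_pow_smul {lam μ : ℚ} {S T U S' T' U' : Cb} {P : Matrix (Fin 3) (Fin 3) Cb}
    (h : Intertwines (triangularMatrix lam S T U) (triangularMatrix μ S' T' U') P) (k : ℕ) :
    Intertwines (triangularMatrix (lam + k) S T U) (triangularMatrix μ S' T' U')
      ((PowerSeries.X : Cb) ^ k • P) := by
  have hshift : triangularMatrix (lam + k) S T U
      = triangularMatrix lam S T U + ((k : Cb) * bVar) • 1 := by
    ext i j : 1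
    fin_cases i <;> fin_cases j <;> simp [triangularMatrix, add_mul]
  have hderiv : ((PowerSeries.X : Cb) ^ k • P).map bDeriv
      = (PowerSeries.X : Cb) ^ k • P.map bDeriv
        + ((k : Cb) * (PowerSeries.X : Cb) ^ (k - 1)) • P := by
    ext i j : 1
    simp [Derivation.leibniz, Derivation.leibniz_pow]
    ring
  have hpow : bVar ^ 2 * ((k : Cb) * (PowerSeries.X : Cb) ^ (k - 1))
      = (PowerSeries.X : Cb) ^ k * ((k : Cb) * bVar) := by
    rcases k with _ | k
    · simp
    · rw [Nat.add_sub_cancel]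
      ring
  rw [Intertwines, hshift, hderiv, smul_add, smul_smul _ _ P, hpow, Matrix.mul_add, smul_mul_assoc,
    h, mul_smul_comm, mul_one, mul_smul_comm, smul_add, smul_comm _ _ (P.map bDeriv),
    smul_smul _ _ P, mul_comm (_ * _) (_ ^ k), add_assoc]

/-- The matrix of an embedding of `E(α,β,γ)` into `Ξ_μ^{(2)}` when `lam = μ + 2`. -/
noncomputable def embMatrix (α β γ : ℂ) : Matrix (Fin 3) (Fin 3) Cb :=
  !![bVar ^ 2, cst γ * bVar ^ 3 - bVar,
      cst 2⁻¹ - cst (β - α) * bVar + cst (α * γ) * bVar ^ 3;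
    0, cst β * bVar ^ 2, cst γ * bVar ^ 2 - cst β * bVar;
    0, 0, cst (α * β) * bVar ^ 2]

theorem det_embMatrix (α β γ : ℂ) :
    (embMatrix α β γ).det = (PowerSeries.X : Cb) ^ 6 * cst (α * β ^ 2) := by
  simp [embMatrix, Matrix.det_fin_three]
  ring

theorem intertwines_embMatrix (μ : ℚ) (α β γ : ℂ) :
    Intertwines (canonicalMatrix (μ + 2) α β γ) (triangularMatrix μ bVar bVar 0)
      (embMatrix α β γ) := by
  have htwo : cst 2 = (2 : Cb) := map_ofNat _ 2
  have hhalf : cst 2⁻¹ * 2 = (1 : Cb) := by rw [← htwo, ← map_mul]; simp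
  have hderiv : (embMatrix α β γ).map bDeriv =
      !![2 * bVar, 3 * cst γ * bVar ^ 2 - 1, -cst (β - α) + 3 * cst (α * γ) * bVar ^ 2;
        0, 2 * cst β * bVar, 2 * cst γ * bVar - cst β;
        0, 0, 2 * cst (α * β) * bVar] := by
    ext i j : 1
    fin_cases i <;> fin_cases j <;>
      simp [embMatrix, Derivation.leibniz, Derivation.leibniz_pow] <;> ring
  rw [Intertwines, hderiv, canonicalMatrix, triangularMatrix, triangularMatrix, embMatrix]
  ext i j : 1
  fin_cases i <;> fin_cases j <;>
    simp only [Matrix.mul_apply, Fin.sum_univ_three, Matrix.add_apply, Matrix.smul_apply] <;>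
    simp only [map_sub, map_add, map_mul, htwo, Matrix.of_apply, Matrix.cons_val',
      Matrix.cons_val_zero, Matrix.cons_val_one, Matrix.cons_val_fin_one, Matrix.cons_val,
      Rat.cast_add, Rat.cast_ofNat, Fin.mk_one, Fin.zero_eta, Fin.isValue, Fin.reduceFinMk,
      smul_eq_mul] <;>
    first | ring1 | linear_combination bVar * hhalf

/-- The map `E(α,β,γ) → Ξ_Λ^{(2)}` with component `b^k embMatrix` at `μ` and zero elsewhere; it
embeds the theme when `lam = μ + 2 + k`. -/
noncomputable def themeEmb (lam : ℚ) (Λ : Finset ℚ) (μ : ℚ) (k : ℕ) (α β γ : ℂ) :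
    CanonicalTheme lam α β γ →ₗ[Cb] Xi Λ 2 :=
  (LinearMap.pi fun ν : Λ => if (ν : ℚ) = μ then
      ((PowerSeries.X : Cb) ^ k • embMatrix α β γ).mulVecLin else 0 :
    (Fin 3 → Cb) →ₗ[Cb] Λ → Fin 3 → Cb)

theorem themeEmb_apply (lam : ℚ) {Λ : Finset ℚ} (μ : ℚ) (k : ℕ) (α β γ : ℂ)
    (x : CanonicalTheme lam α β γ) (ν : Λ) :
    themeEmb lam Λ μ k α β γ x ν =
      if (ν : ℚ) = μ then ((PowerSeries.X : Cb) ^ k • embMatrix α β γ).mulVec x else 0 := by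
  change (if (ν : ℚ) = μ then _ else _ : (Fin 3 → Cb) →ₗ[Cb] Fin 3 → Cb) x = _
  split_ifs <;> rfl

theorem isABLinear_themeEmb (Λ : Finset ℚ) (μ : ℚ) (k : ℕ) (α β γ : ℂ) :
    IsABLinear (themeEmb (μ + 2 + k) Λ μ k α β γ) := fun x => by
  have ha : (ABModule.a x : CanonicalTheme (μ + 2 + k) α β γ)
      = connection (canonicalMatrix (μ + 2 + k) α β γ) x := canonicalA_eq_connection _ _ _ _ x
  funext ν
  rw [xi_a_apply, themeEmb_apply, themeEmb_apply]
  split_ifs with hν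
  · rw [hν, ha]
    exact ((intertwines_embMatrix μ α β γ).X_pow_smul k).mulVec_connection x
  · funext i
    simp [connection]

theorem themeEmb_injective (lam : ℚ) {Λ : Finset ℚ} {μ : ℚ} (hμ : μ ∈ Λ) (k : ℕ) {α β : ℂ}
    (hα : α ≠ 0) (hβ : β ≠ 0) (γ : ℂ) : Function.Injective (themeEmb lam Λ μ k α β γ) := by
  have hdet : ((PowerSeries.X : Cb) ^ k • embMatrix α β γ).det ≠ 0 := by
    simp [det_embMatrix, PowerSeries.X_ne_zero, hα, hβ]
  refine fun x y hxy => Matrix.mulVec_injective_of_det_ne_zero hdet ?_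
  simpa [themeEmb_apply] using congrFun hxy ⟨μ, hμ⟩

/-- The generator `e₃` of `E(α,β,γ)`. -/
noncomputable def themeGen (lam : ℚ) (α β γ : ℂ) : CanonicalTheme lam α β γ :=
  (![0, 0, 1] : Fin 3 → Cb)

theorem isCyclicVector_canonicalTheme_iff {lam : ℚ} {α β γ : ℂ} {c : CanonicalTheme lam α β γ} :
    IsCyclicVector 3 c ↔ PowerSeries.constantCoeff (c 2) ≠ 0 := by
  rw [isCyclicVector_iff (hasConnectionMatrix_themeBasis lam α β γ), themeBasis_repr]
  simp

theorem isCyclicVector_themeGen (lam : ℚ) (α β γ : ℂ) : IsCyclicVector 3 (themeGen lam α β γ) :=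
  isCyclicVector_canonicalTheme_iff.2 (by simp [themeGen])

theorem exists_residue {lam : ℚ} (hlam : 2 < lam) :
    ∃ (μ : ℚ) (k : ℕ), 0 < μ ∧ μ ≤ 1 ∧ lam = μ + 2 + k := by
  have hceil : (2 : ℤ) < ⌈lam⌉ := Int.lt_ceil.2 (by exact_mod_cast hlam)
  obtain ⟨k, hk⟩ := Int.eq_ofNat_of_zero_le (show 0 ≤ ⌈lam⌉ - 3 by omega)
  have hk' : (⌈lam⌉ : ℚ) - 3 = k := by exact_mod_cast hk
  exact ⟨lam - (⌈lam⌉ - 1), k, by linarith [Int.ceil_lt_add_one lam],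
    by linarith [Int.le_ceil lam], by linarith⟩

theorem isPrimitiveTheme_canonicalTheme {lam : ℚ} (hlam : 2 < lam) {α β : ℂ} (hα : α ≠ 0)
    (hβ : β ≠ 0) (γ : ℂ) : IsPrimitiveTheme lam (CanonicalTheme lam α β γ) := by
  obtain ⟨μ, k, hpos, hle, rfl⟩ := exists_residue hlam
  have hι := isABLinear_themeEmb {μ} μ k α β γ
  exact ⟨μ, hpos, hle, ⟨k + 2, by push_cast; ring⟩, 2,
    themeEmb _ {μ} μ k α β γ (themeGen _ α β γ), themeEmb _ {μ} μ k α β γ, hι,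
    themeEmb_injective _ (Finset.mem_singleton_self μ) k hα hβ γ,
    hι.range_eq_span_aPow (isCyclicVector_themeGen _ α β γ).span_aPow_eq_top⟩

theorem isThemeWithInvariants_canonicalTheme {lam : ℚ} (hlam : 2 < lam) {α β : ℂ} (hα : α ≠ 0)
    (hβ : β ≠ 0) (γ : ℂ) :
    IsThemeWithInvariants (fun _ : Fin 3 => lam) (CanonicalTheme lam α β γ) :=
  ⟨fun _ => isPrimitiveTheme_canonicalTheme hlam hα hβ γ,
    (hasConnectionMatrix_themeBasis lam α β γ).hasFundamentalInvariants⟩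

end Embedding

section Euler

/-- The Euler operator `b d/db + c`. -/
noncomputable def euler (c : ℂ) (p : Cb) : Cb := bVar * bDeriv p + cst c * p

theorem coeff_euler (c : ℂ) (p : Cb) (n : ℕ) :
    PowerSeries.coeff n (euler c p) = (n + c) * PowerSeries.coeff n p := by
  rcases n with _ | n
  · simp [euler]
  · simp [euler, PowerSeries.coeff_succ_X_mul, PowerSeries.coeff_derivative]
    ring

theorem eq_zero_of_euler_eq_zero {c : ℂ} (hc : ∀ n : ℕ, (n : ℂ) + c ≠ 0) {p : Cb}
    (hp : euler c p = 0) : p = 0 := PowerSeries.ext fun n => by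
  simpa [coeff_euler, hc n] using congrArg (PowerSeries.coeff n) hp

theorem eq_of_euler_neg_natCast_eq_zero {m : ℕ} {p : Cb} (hp : euler (-m) p = 0) :
    p = cst (PowerSeries.coeff m p) * (PowerSeries.X : Cb) ^ m := PowerSeries.ext fun n => by
  have hn := congrArg (PowerSeries.coeff n) hp
  rw [coeff_euler, map_zero, mul_eq_zero, add_neg_eq_zero, Nat.cast_inj] at hn
  rw [PowerSeries.coeff_C_mul_X_pow]
  split_ifs with hnm
  · rw [hnm]
  · exact hn.resolve_left hnm

-- The image of `b d/db - m` has no term in `b^m`, so a Jordan chain stops after one step.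
theorem eq_zero_of_euler_neg_natCast_add_eq_zero {m : ℕ} {p q : Cb} (hq : euler (-m) q = 0)
    (hp : euler (-m) p + q = 0) : q = 0 := by
  have hcoeff : PowerSeries.coeff m q = 0 := by
    simpa [coeff_euler] using congrArg (PowerSeries.coeff m) hp
  rw [eq_of_euler_neg_natCast_eq_zero hq, hcoeff, cst, map_zero, zero_mul]

theorem exists_eq_of_euler_eq_X_pow_mul {m j : ℕ} (hj : j < m) {p r : Cb}
    (hp : euler (-m) p = (PowerSeries.X : Cb) ^ j * r) :
    ∃ q, p = (PowerSeries.X : Cb) ^ j *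
      (cst (PowerSeries.constantCoeff r / (j - m)) + bVar * q) := by
  have hne : ∀ n ≤ j, (n : ℂ) + -m ≠ 0 := fun n hn => by
    rw [← sub_eq_add_neg, sub_ne_zero, Nat.cast_inj.ne]
    omega
  obtain ⟨p', rfl⟩ : (PowerSeries.X : Cb) ^ j ∣ p := PowerSeries.X_pow_dvd_iff.2 fun n hn => by
    have hcoeff := congrArg (PowerSeries.coeff n) hp
    rw [coeff_euler, PowerSeries.coeff_X_pow_mul', if_neg hn.not_ge] at hcoeff
    exact (mul_eq_zero.1 hcoeff).resolve_left (hne n hn.le)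
  have hconst : PowerSeries.constantCoeff r / (j - m) = PowerSeries.constantCoeff p' := by
    have hcoeff := congrArg (PowerSeries.coeff j) hp
    simp only [coeff_euler, PowerSeries.coeff_X_pow_mul', le_refl, if_true, Nat.sub_self,
      PowerSeries.coeff_zero_eq_constantCoeff_apply] at hcoeff
    rw [← hcoeff, ← sub_eq_add_neg,
      mul_div_cancel_left₀ _ (by simpa [sub_eq_add_neg] using hne j le_rfl)]
  exact ⟨_, congrArg _ (hconst ▸ (PowerSeries.eq_X_mul_shift_add_const p').trans (add_comm _ _))⟩

theorem exists_eq_of_X_mul_euler_add_eq {m j : ℕ} (hj : j < m) {p q r : Cb}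
    (h : bVar * (euler (-m) p + (PowerSeries.X : Cb) ^ (j + 1) * q)
      = (PowerSeries.X : Cb) ^ (j + 1) * r) :
    ∃ p', p = (PowerSeries.X : Cb) ^ j *
      (cst (PowerSeries.constantCoeff r / (j - m)) + bVar * p') := by
  have heuler : euler (-m) p = (PowerSeries.X : Cb) ^ j * (r - bVar * q) :=
    mul_left_cancel₀ PowerSeries.X_ne_zero (by linear_combination h)
  simpa using exists_eq_of_euler_eq_X_pow_mul hj heuler

end Euler

section Lattice

variable {lam ν : ℚ} {S T U : Cb} {Q : Matrix (Fin 3) (Fin 3) Cb}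

theorem mul_triangularMatrix_zero (Q : Matrix (Fin 3) (Fin 3) Cb) (S T U : Cb) (i : Fin 3) :
    (Q * triangularMatrix 0 S T U) i 0 = 0 ∧ (Q * triangularMatrix 0 S T U) i 1 = Q i 0 * S ∧
      (Q * triangularMatrix 0 S T U) i 2 = Q i 0 * U + Q i 1 * T := by
  simp [triangularMatrix, Matrix.mul_apply, Fin.sum_univ_three]

theorem Intertwines.euler_eq
    (h : Intertwines (triangularMatrix lam S T U) (triangularMatrix ν bVar bVar 0) Q) (j : Fin 3) :
    bVar * (euler (ν - lam) (Q 0 j) + Q 1 j) = (Q * triangularMatrix 0 S T U) 0 j ∧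
      bVar * (euler (ν - lam) (Q 1 j) + Q 2 j) = (Q * triangularMatrix 0 S T U) 1 j ∧
      bVar * euler (ν - lam) (Q 2 j) = (Q * triangularMatrix 0 S T U) 2 j := by
  have hshift : triangularMatrix lam S T U
      = triangularMatrix 0 S T U + (cst (lam : ℂ) * bVar) • 1 := by
    ext i j : 1
    fin_cases i <;> fin_cases j <;> simp [triangularMatrix]
  rw [Intertwines, hshift, Matrix.mul_add, mul_smul_comm, mul_one] at h
  have hrow : ∀ i, (Q * triangularMatrix 0 S T U) i j + cst (lam : ℂ) * bVar * Q i j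
      = ∑ l, triangularMatrix ν bVar bVar 0 i l * Q l j + bVar ^ 2 * bDeriv (Q i j) :=
    fun i => congrFun (congrFun h i) j
  simp only [Fin.sum_univ_three, euler, map_sub] at hrow ⊢
  refine ⟨?_, ?_, ?_⟩
  · linear_combination (norm := (simp [triangularMatrix]; ring)) -hrow 0
  · linear_combination (norm := (simp [triangularMatrix]; ring)) -hrow 1
  · linear_combination (norm := (simp [triangularMatrix]; ring)) -hrow 2

theorem Intertwines.eq_zero
    (h : Intertwines (triangularMatrix lam S T U) (triangularMatrix ν bVar bVar 0) Q)
    (hν : ∀ n : ℕ, lam ≠ ν + n) : Q = 0 := by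
  have hc : ∀ n : ℕ, (n : ℂ) + (ν - lam) ≠ 0 := fun n hn =>
    hν n (by exact_mod_cast (show (lam : ℂ) = ν + n by linear_combination -hn))
  have hcol : ∀ j, (∀ i, (Q * triangularMatrix 0 S T U) i j = 0) → ∀ i, Q i j = 0 := by
    intro j hj
    obtain ⟨h0, h1, h2⟩ := h.euler_eq j
    simp only [hj, mul_eq_zero, PowerSeries.X_ne_zero, false_or] at h0 h1 h2
    have hQ2 := eq_zero_of_euler_eq_zero hc h2
    rw [hQ2, add_zero] at h1
    have hQ1 := eq_zero_of_euler_eq_zero hc h1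
    rw [hQ1, add_zero] at h0
    exact fun i => by fin_cases i; exacts [eq_zero_of_euler_eq_zero hc h0, hQ1, hQ2]
  have hmul := mul_triangularMatrix_zero Q S T U
  have hcol0 := hcol 0 fun i => (hmul i).1
  have hcol1 := hcol 1 fun i => by rw [(hmul i).2.1, hcol0, zero_mul]
  have hcol2 := hcol 2 fun i => by rw [(hmul i).2.2, hcol0, hcol1, zero_mul, zero_mul, add_zero]
  ext i j : 1
  fin_cases j
  exacts [hcol0 i, hcol1 i, hcol2 i]

/-- The general shape, up to a power of `b`, of the matrix of a map from a rank 3 theme to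
`Ξ_μ^{(2)}`. -/
noncomputable def latticeMatrix (c d e s t u : ℂ) (P R W : Cb) : Matrix (Fin 3) (Fin 3) Cb :=
  !![cst c * bVar ^ 2, -(cst s * bVar) + bVar ^ 2 * P, cst (u / 2) + bVar * W;
    0, cst d * bVar ^ 2, -(cst t * bVar) + bVar ^ 2 * R;
    0, 0, cst e * bVar ^ 2]

theorem det_latticeMatrix (c d e s t u : ℂ) (P R W : Cb) :
    (latticeMatrix c d e s t u P R W).det = (PowerSeries.X : Cb) ^ 6 * cst (c * d * e) := by
  simp [latticeMatrix, Matrix.det_fin_three]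
  ring

theorem Intertwines.exists_upperTriangular_of_resonant {m : ℕ} (hm : lam = ν + m)
    (h : Intertwines (triangularMatrix lam S T U) (triangularMatrix ν bVar bVar 0) Q) :
    (Q 1 0 = 0 ∧ Q 2 0 = 0 ∧ Q 2 1 = 0) ∧ ∃ c d e : ℂ, Q 0 0 = cst c * (PowerSeries.X : Cb) ^ m ∧
      Q 1 1 = cst d * (PowerSeries.X : Cb) ^ m ∧ Q 2 2 = cst e * (PowerSeries.X : Cb) ^ m := by
  have hc : ((ν : ℂ) - lam) = -m := by rw [hm]; push_cast; ring
  have heq := h.euler_eq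
  have hmul := mul_triangularMatrix_zero Q S T U
  rw [hc] at heq
  obtain ⟨h00, h10, h20⟩ := heq 0
  simp only [(hmul _).1, mul_eq_zero, PowerSeries.X_ne_zero, false_or] at h00 h10 h20
  have hQ20 := eq_zero_of_euler_neg_natCast_add_eq_zero h20 h10
  rw [hQ20, add_zero] at h10
  have hQ10 := eq_zero_of_euler_neg_natCast_add_eq_zero h10 h00
  rw [hQ10, add_zero] at h00
  obtain ⟨-, h11, h21⟩ := heq 1
  simp only [(hmul _).2.1, hQ20, hQ10, zero_mul, mul_eq_zero, PowerSeries.X_ne_zero, false_or]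
    at h11 h21
  have hQ21 := eq_zero_of_euler_neg_natCast_add_eq_zero h21 h11
  rw [hQ21, add_zero] at h11
  obtain ⟨-, -, h22⟩ := heq 2
  simp only [(hmul _).2.2, hQ20, hQ21, zero_mul, add_zero, mul_eq_zero, PowerSeries.X_ne_zero,
    false_or] at h22
  exact ⟨⟨hQ10, hQ20, hQ21⟩, _, _, _, eq_of_euler_neg_natCast_eq_zero h00,
    eq_of_euler_neg_natCast_eq_zero h11, eq_of_euler_neg_natCast_eq_zero h22⟩

theorem Intertwines.exists_eq_latticeMatrix {k : ℕ}
    (h : Intertwines (triangularMatrix (ν + 2 + k) S T U) (triangularMatrix ν bVar bVar 0) Q) :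
    ∃ (c d e : ℂ) (P R W : Cb), Q = (PowerSeries.X : Cb) ^ k • latticeMatrix c d e
      (c * PowerSeries.constantCoeff S) (d * PowerSeries.constantCoeff T)
      (c * PowerSeries.constantCoeff S * PowerSeries.constantCoeff T) P R W := by
  obtain ⟨⟨hQ10, hQ20, hQ21⟩, c, d, e, hQ00, hQ11, hQ22⟩ :=
    h.exists_upperTriangular_of_resonant (m := k + 2) (by push_cast; ring)
  have hc : ((ν : ℂ) - ((ν + 2 + k : ℚ) : ℂ)) = -((k + 2 : ℕ) : ℂ) := by push_cast; ring
  have heq := h.euler_eq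
  have hmul := mul_triangularMatrix_zero Q S T U
  rw [hc] at heq
  have hone : ∀ z : ℂ, z / (((k + 1 : ℕ) : ℂ) - ((k + 2 : ℕ) : ℂ)) = -z := fun z => by
    rw [show ((k + 1 : ℕ) : ℂ) - ((k + 2 : ℕ) : ℂ) = -1 by push_cast; ring, div_neg, div_one]
  have htwo : ∀ z : ℂ, z / ((k : ℂ) - ((k + 2 : ℕ) : ℂ)) = -(z / 2) := fun z => by
    rw [show (k : ℂ) - ((k + 2 : ℕ) : ℂ) = -2 by push_cast; ring, div_neg]
  obtain ⟨P, hP⟩ := exists_eq_of_X_mul_euler_add_eq (m := k + 2) (j := k + 1) (p := Q 0 1)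
    (q := cst d) (r := cst c * S) (lt_add_one _) (by
      have h01 := (heq 1).1
      rw [(hmul 0).2.1, hQ00, hQ11] at h01
      linear_combination h01)
  obtain ⟨R, hR⟩ := exists_eq_of_X_mul_euler_add_eq (m := k + 2) (j := k + 1) (p := Q 1 2)
    (q := cst e) (r := cst d * T) (lt_add_one _) (by
      have h12 := (heq 2).2.1
      rw [(hmul 1).2.2, hQ10, hQ11, hQ22] at h12
      linear_combination h12)
  simp only [hone, map_mul, PowerSeries.constantCoeff_C] at hP hR
  obtain ⟨W, hW⟩ := exists_eq_of_X_mul_euler_add_eq (m := k + 2) (j := k) (p := Q 0 2)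
    (q := cst (-(d * PowerSeries.constantCoeff T)) + bVar * R)
    (r := cst c * bVar * U + (cst (-(c * PowerSeries.constantCoeff S)) + bVar * P) * T)
    (Nat.lt_add_of_pos_right two_pos) (by
      have h02 := (heq 2).1
      rw [(hmul 0).2.2, hQ00, hP, hR] at h02
      linear_combination h02)
  simp only [htwo, map_add, map_mul, PowerSeries.constantCoeff_C, PowerSeries.constantCoeff_X,
    mul_zero, zero_mul, zero_add, add_zero] at hW
  refine ⟨c, d, e, P, R, W, ?_⟩
  ext i j : 1
  fin_cases i <;> fin_cases j <;>
    simp [latticeMatrix, hQ10, hQ20, hQ21, hQ00, hQ11, hQ22, hP, hR, hW, neg_div] <;> ring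

end Lattice

section LatticeTheme

theorem exists_latticeMatrix_eq_embMatrix_mul {c d e s t u : ℂ} (hc : c ≠ 0) (hd : d ≠ 0)
    (he : e ≠ 0) (hs : s ≠ 0) (ht : t ≠ 0) (hu : u ≠ 0) (hst : d * u = s * t) (P R W : Cb) :
    ∃ (α β γ : ℂ) (V : Matrix (Fin 3) (Fin 3) Cb), α ≠ 0 ∧ β ≠ 0 ∧ IsUnit V.det ∧
      latticeMatrix c d e s t u P R W = embMatrix α β γ * V := by
  obtain ⟨β, hβ, rfl⟩ : ∃ β, β ≠ 0 ∧ d = β * s :=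
    ⟨d / s, div_ne_zero hd hs, (div_mul_cancel₀ d hs).symm⟩
  obtain rfl : t = β * u := mul_left_cancel₀ hs (by linear_combination -hst)
  obtain ⟨α, hα, rfl⟩ : ∃ α, α ≠ 0 ∧ e = α * (β * u) :=
    ⟨e / (β * u), div_ne_zero he ht, (div_mul_cancel₀ e ht).symm⟩
  obtain ⟨R', r, rfl⟩ : ∃ R' r, R = bVar * R' + cst r := ⟨_, _, R.eq_X_mul_shift_add_const⟩
  obtain ⟨W', w, rfl⟩ : ∃ W' w, W = bVar * W' + cst w := ⟨_, _, W.eq_X_mul_shift_add_const⟩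
  obtain ⟨γ, hγ⟩ : ∃ γ, γ * u = β * (w + (β - α) * u) + r := ⟨_, div_mul_cancel₀ _ hu⟩
  have hinv : cst β⁻¹ * cst β = 1 := by rw [← map_mul, inv_mul_cancel₀ hβ, map_one]
  have hγ' : cst γ * cst u = cst β * (cst w + (cst β - cst α) * cst u) + cst r := by
    simpa only [map_mul, map_add, map_sub] using congrArg (PowerSeries.C (R := ℂ)) hγ
  let V₁₂ : Cb := cst β⁻¹ * (bVar * R' + cst r - cst γ * cst u)
  refine ⟨α, β, γ, !![cst c, P - cst γ * cst s * bVar,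
      W' + cst β⁻¹ * R' - cst γ * bVar * V₁₂ - cst α * cst γ * cst u * bVar;
    0, cst s, V₁₂; 0, 0, cst u], hα, hβ, ?_, ?_⟩
  · rw [PowerSeries.isUnit_iff_constantCoeff]
    simp [Matrix.det_fin_three, hc, hs, hu]
  · have hhalf : cst (u / 2) = cst 2⁻¹ * cst u := by rw [← map_mul, div_eq_inv_mul]
    ext i j : 1
    fin_cases i <;> fin_cases j <;>
      simp [latticeMatrix, embMatrix, Matrix.mul_apply, Fin.sum_univ_three, V₁₂, -map_inv₀]
    · ring
    · ring
    · linear_combination hhalf - bVar * cst β⁻¹ * hγ'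
        - bVar * (cst w + (cst β - cst α) * cst u) * hinv
    · ring
    · linear_combination -bVar ^ 2 * (bVar * R' + cst r - cst γ * cst u) * hinv
    · ring

theorem ne_add_natCast {μ ν : ℚ} (hμ0 : 0 < μ) (hμ1 : μ ≤ 1) (hν0 : 0 < ν) (hν1 : ν ≤ 1)
    (hne : ν ≠ μ) {k : ℕ} (n : ℕ) : μ + 2 + k ≠ ν + n := fun h => by
  have hlt : n < k + 3 := by
    have : (n : ℚ) < k + 3 := by linarith
    exact_mod_cast this
  have hgt : k + 1 < n := by
    have : (k : ℚ) + 1 < n := by linarith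
    exact_mod_cast this
  obtain rfl : n = k + 2 := by omega
  push_cast at h
  exact hne (by linarith)

theorem exists_matrix_of_isABLinear_xi {μ : ℚ} (hμ0 : 0 < μ) (hμ1 : μ ≤ 1) {k : ℕ}
    {Λ : Finset ℚ} (hΛ : ∀ ν ∈ Λ, 0 < ν ∧ ν ≤ 1) {E : Type*} [AddCommGroup E] [Module Cb E]
    [ABModule E] {e : Module.Basis (Fin 3) Cb E} {S T U : Cb}
    (he : HasConnectionMatrix e (triangularMatrix (μ + 2 + k) S T U)) {θ : E →ₗ[Cb] Xi Λ 2}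
    (hθ : IsABLinear θ) (hinj : Function.Injective θ) :
    μ ∈ Λ ∧ ∃ Q : Matrix (Fin 3) (Fin 3) Cb, Q.det ≠ 0 ∧
      Intertwines (triangularMatrix (μ + 2 + k) S T U) (triangularMatrix μ bVar bVar 0) Q ∧
      ∀ v ν, θ v ν = if (ν : ℚ) = μ then Q.mulVec (e.repr v) else 0 := by
  let q (ν : Λ) : E →ₗ[Cb] Fin 3 → Cb :=
    LinearMap.proj (φ := fun _ : Λ => Fin 3 → Cb) ν ∘ₗ θ
  let Q (ν : Λ) := LinearMap.toMatrix e (Pi.basisFun Cb (Fin 3)) (q ν)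
  have hQ (ν : Λ) : Intertwines (triangularMatrix (μ + 2 + k) S T U)
      (triangularMatrix ν bVar bVar 0) (Q ν) := he.intertwines_toMatrix fun v => by
    change (θ (ABModule.a v)) ν = connection _ (θ v ν)
    rw [hθ v, xi_a_apply]
  have hQθ (ν : Λ) (v : E) : (Q ν).mulVec (e.repr v) = θ v ν :=
    LinearMap.toMatrix_mulVec_repr e (Pi.basisFun Cb (Fin 3)) (q ν) v
  have hzero (ν : Λ) (hν : (ν : ℚ) ≠ μ) (v : E) : θ v ν = 0 := by
    have hQν : Q ν = 0 := (hQ ν).eq_zero (ne_add_natCast hμ0 hμ1 (hΛ ν ν.2).1 (hΛ ν ν.2).2 hν)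
    rw [← hQθ, hQν, Matrix.zero_mulVec]
  have hμ : μ ∈ Λ := by
    by_contra hμ
    exact e.ne_zero 0 ((injective_iff_map_eq_zero θ).1 hinj _
      (funext fun ν => hzero ν (fun h => hμ (h ▸ ν.2)) _))
  have hθQ (v : E) (ν : Λ) :
      θ v ν = if (ν : ℚ) = μ then (Q ⟨μ, hμ⟩).mulVec (e.repr v) else 0 := by
    split_ifs with hν
    · obtain rfl : ν = ⟨μ, hμ⟩ := Subtype.ext hν
      exact (hQθ _ v).symm
    · exact hzero ν hν v
  refine ⟨hμ, Q ⟨μ, hμ⟩, ?_, hQ ⟨μ, hμ⟩, hθQ⟩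
  rw [Ne, ← Matrix.exists_mulVec_eq_zero_iff]
  rintro ⟨x, hx0, hx⟩
  obtain ⟨v, rfl⟩ := e.equivFun.surjective x
  rw [e.equivFun_apply] at hx
  have hv : v = 0 := (injective_iff_map_eq_zero θ).1 hinj v <| funext fun ν => by
    rw [hθQ, hx, ite_self]
    rfl
  exact hx0 (by rw [hv, map_zero])

theorem exists_range_eq_range_themeEmb {μ : ℚ} (hμ0 : 0 < μ) (hμ1 : μ ≤ 1) {k : ℕ}
    {Λ : Finset ℚ} (hΛ : ∀ ν ∈ Λ, 0 < ν ∧ ν ≤ 1) {E : Type*} [AddCommGroup E] [Module Cb E]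
    [ABModule E] (hE : HasFundamentalInvariants (fun _ : Fin 3 => μ + 2 + k) E)
    (hcyc : ∃ c : E, IsCyclicVector 3 c) {θ : E →ₗ[Cb] Xi Λ 2} (hθ : IsABLinear θ)
    (hinj : Function.Injective θ) :
    μ ∈ Λ ∧ ∃ α β γ : ℂ, α ≠ 0 ∧ β ≠ 0 ∧
      LinearMap.range (themeEmb (μ + 2 + k) Λ μ k α β γ) = LinearMap.range θ := by
  obtain ⟨e, S, T, U, he⟩ := exists_triangular_basis hE
  obtain ⟨c, hc⟩ := hcyc
  obtain ⟨hS, hT, -⟩ := (isCyclicVector_iff he c).1 hc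
  obtain ⟨hμ, Q, hdet, hQ, hθQ⟩ := exists_matrix_of_isABLinear_xi hμ0 hμ1 hΛ he hθ hinj
  obtain ⟨x, y, z, P, R, W, rfl⟩ := hQ.exists_eq_latticeMatrix
  rw [Matrix.det_smul, det_latticeMatrix] at hdet
  obtain ⟨hx, hy, hz⟩ : x ≠ 0 ∧ y ≠ 0 ∧ z ≠ 0 := by
    simpa [PowerSeries.X_ne_zero, and_assoc] using hdet
  obtain ⟨α, β, γ, V, hα, hβ, hV, hfactor⟩ := exists_latticeMatrix_eq_embMatrix_mul hx hy hz
    (mul_ne_zero hx hS) (mul_ne_zero hy hT) (mul_ne_zero (mul_ne_zero hx hS) hT) (by ring) P R W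
  refine ⟨hμ, α, β, γ, hα, hβ, ?_⟩
  let ψ : E →ₗ[Cb] CanonicalTheme (μ + 2 + k) α β γ := V.mulVecLin ∘ₗ e.equivFun.toLinearMap
  have hψ : LinearMap.range ψ = ⊤ := LinearMap.range_eq_top.2 <|
    (Matrix.mulVec_surjective_iff_isUnit.2 ((Matrix.isUnit_iff_isUnit_det V).2 hV)).comp
      e.equivFun.surjective
  have hθψ : θ = themeEmb (μ + 2 + k) Λ μ k α β γ ∘ₗ ψ := LinearMap.ext fun v => funext fun ν => by
    rw [LinearMap.comp_apply, themeEmb_apply, hθQ, hfactor, ← smul_mul_assoc,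
      ← Matrix.mulVec_mulVec]
    rfl
  rw [hθψ, LinearMap.range_comp_of_range_eq_top _ hψ]

end LatticeTheme

section Families

open ReducedComplexSpace

variable {M : Type u} [TopologicalSpace M] [ReducedComplexSpace M] {x : M}

section Matrix

variable {ι : Type*} [Fintype ι] {A : M → Matrix ι ι Cb} {t : M → ι → Cb}

theorem IsHolSeriesAt.connection (hA : ∀ i j, IsHolSeriesAt (fun y => A y i j) x)
    (ht : ∀ i, IsHolSeriesAt (fun y => t y i) x) (i : ι) :
    IsHolSeriesAt (fun y => connection (A y) (t y) i) x :=
  (mulVec hA ht i).add ((const _ x).mul (ht i).deriv)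

variable [DecidableEq ι]

theorem IsHolSeriesAt.eventually_isUnit_det (hA : ∀ i j, IsHolSeriesAt (fun y => A y i j) x)
    (hu : IsUnit (A x).det) : ∀ᶠ y in 𝓝 x, IsUnit (A y).det := by
  simp only [PowerSeries.isUnit_iff_constantCoeff, isUnit_iff_ne_zero] at hu ⊢
  exact (det hA).eventually_constantCoeff_ne_zero hu

theorem IsHolSeriesAt.inv_mulVec (hA : ∀ i j, IsHolSeriesAt (fun y => A y i j) x)
    (hu : IsUnit (A x).det) (ht : ∀ i, IsHolSeriesAt (fun y => t y i) x) :
    ∀ i, IsHolSeriesAt (fun y => (A y)⁻¹.mulVec (t y) i) x := by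
  have hu0 : PowerSeries.constantCoeff (A x).det ≠ 0 := (hu.map _).ne_zero
  refine (mulVec_iff hA (det hA) (n := 0) (by simp) hu0).1 fun i => (ht i).congr ?_
  filter_upwards [eventually_isUnit_det hA hu] with y hy
  rw [Matrix.mulVec_mulVec, Matrix.mul_nonsing_inv _ hy, Matrix.one_mulVec]

theorem IsHolSeriesAt.forall_iff_exists_mulVec (hA : ∀ i j, IsHolSeriesAt (fun y => A y i j) x)
    (hu : IsUnit (A x).det) :
    (∀ i, IsHolSeriesAt (fun y => t y i) x) ↔ ∃ g : ι → M → Cb,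
      (∀ i, IsHolSeriesAt (g i) x) ∧ ∀ᶠ y in 𝓝 x, t y = (A y).mulVec fun i => g i y := by
  constructor
  · refine fun ht => ⟨fun i y => (A y)⁻¹.mulVec (t y) i, inv_mulVec hA hu ht, ?_⟩
    filter_upwards [eventually_isUnit_det hA hu] with y hy
    rw [Matrix.mulVec_mulVec, Matrix.mul_nonsing_inv _ hy, Matrix.one_mulVec]
  · rintro ⟨g, hg, heq⟩ i
    exact (mulVec hA hg i).congr (heq.mono fun y hy => congrFun hy.symm i)

end Matrix

variable {lam : ℚ} {α β γ : M → ℂ}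

theorem isHolSeriesAt_canonicalMatrix (lam : ℚ) (hα : IsHolAt α x) (hβ : IsHolAt β x)
    (hγ : IsHolAt γ x) (i j : Fin 3) :
    IsHolSeriesAt (fun y => canonicalMatrix lam (α y) (β y) (γ y) i j) x := by
  have hβγ := ((IsHolSeriesAt.const 1 x).add ((IsHolSeriesAt.of_cst hβ).mul (.const bVar x))).add
    ((IsHolSeriesAt.of_cst hγ).mul (.const (bVar ^ 2) x))
  have hα' := (IsHolSeriesAt.const 1 x).add ((IsHolSeriesAt.of_cst hα).mul (.const bVar x))
  fin_cases i <;> fin_cases j <;> first | exact IsHolSeriesAt.const _ x | exact hβγ | exact hα'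

variable {c t : ∀ y, CanonicalTheme lam (α y) (β y) (γ y)}

theorem isHolSeriesAt_a (hα : IsHolAt α x) (hβ : IsHolAt β x) (hγ : IsHolAt γ x)
    (hc : ∀ i, IsHolSeriesAt (fun y => c y i) x) (i : Fin 3) :
    IsHolSeriesAt (fun y => (ABModule.a (c y) : CanonicalTheme lam _ _ _) i) x :=
  (IsHolSeriesAt.connection (isHolSeriesAt_canonicalMatrix lam hα hβ hγ) hc i).congr <|
    .of_forall fun y => congrFun (canonicalA_eq_connection lam (α y) (β y) (γ y) (c y)).symm i

theorem isHolSeriesAt_aPow (hα : IsHolAt α x) (hβ : IsHolAt β x) (hγ : IsHolAt γ x)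
    (hc : ∀ i, IsHolSeriesAt (fun y => c y i) x) (n : ℕ) (i : Fin 3) :
    IsHolSeriesAt (fun y => aPow n (c y) i) x := by
  induction n generalizing i with
  | zero => exact hc i
  | succ n ih =>
    simp only [aPow_succ]
    exact isHolSeriesAt_a hα hβ hγ ih i

theorem toMatrix_themeBasis_mulVec {lam : ℚ} {α β γ : ℂ} {k : ℕ}
    (v : Fin k → CanonicalTheme lam α β γ) (g : Fin k → Cb) :
    ((themeBasis lam α β γ).toMatrix v).mulVec g = ∑ j, g j • v j := by
  have hrepr : ∀ w : CanonicalTheme lam α β γ, ⇑((themeBasis lam α β γ).repr w) = w := fun _ => rfl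
  rw [← hrepr (∑ j, g j • v j)]
  funext i
  simp [Matrix.mulVec, dotProduct, Module.Basis.toMatrix_apply, mul_comm]

/-- The family with fibers `E(α(x),β(x),γ(x))` and sections holomorphic in the basis `e₁, e₂, e₃`.
-/
noncomputable def canonicalFamily (lam : ℚ) (α β γ : M → ℂ) (hα : ∀ x, IsHolAt α x)
    (hβ : ∀ x, IsHolAt β x) (hγ : ∀ x, IsHolAt γ x) : ABFamily.{u, 0} M where
  fib x := CanonicalTheme lam (α x) (β x) (γ x)
  IsHolAt t x := ∀ i, IsHolSeriesAt (fun y => t y i) x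
  exists_frame _ := by
    refine ⟨Set.univ, 3, fun i x => themeBasis lam (α x) (β x) (γ x) i, isOpen_univ, trivial,
      fun x _ => ⟨⟨(themeBasis lam _ _ _).linearIndependent, (themeBasis lam _ _ _).span_eq⟩,
        fun t => ?_⟩⟩
    have hsum : ∀ (z : M) (g : Fin 3 → Cb), ∑ i, g i • themeBasis lam (α z) (β z) (γ z) i = g :=
      fun z g => (themeBasis lam (α z) (β z) (γ z)).sum_repr g
    constructor
    · exact fun ht => ⟨fun i z => t z i, ht, .of_forall fun z => (hsum z (t z)).symm⟩
    · rintro ⟨g, hg, ht⟩ i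
      exact (hg i).congr <| ht.mono fun z hz =>
        (congrFun (hz.trans (hsum z fun i => g i z)) i).symm
  a_hol _ x ht := isHolSeriesAt_a (hα x) (hβ x) (hγ x) ht

theorem isHolSeriesAt_toMatrix_aPow (hα : IsHolAt α x) (hβ : IsHolAt β x) (hγ : IsHolAt γ x)
    (hc : ∀ i, IsHolSeriesAt (fun y => c y i) x) (i j : Fin 3) :
    IsHolSeriesAt (fun y =>
      (themeBasis lam (α y) (β y) (γ y)).toMatrix (fun j : Fin 3 => aPow j (c y)) i j) x :=
  isHolSeriesAt_aPow hα hβ hγ hc j i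

theorem IsCyclicVector.isUnit_det_toMatrix {lam : ℚ} {α β γ : ℂ} {c : CanonicalTheme lam α β γ}
    (hc : IsCyclicVector 3 c) :
    IsUnit ((themeBasis lam α β γ).toMatrix fun j : Fin 3 => aPow j c).det :=
  (isCyclicVector_iff_isUnit_det (themeBasis lam α β γ) c).1 hc

theorem isHolSeriesAt_iff_exists_sum_aPow_map {F : Type*} [AddCommGroup F] [Module Cb F]
    [ABModule F] {ι : ∀ y, CanonicalTheme lam (α y) (β y) (γ y) →ₗ[Cb] F} (hα : IsHolAt α x)
    (hβ : IsHolAt β x) (hγ : IsHolAt γ x) (hc : ∀ i, IsHolSeriesAt (fun y => c y i) x)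
    (hcyc : IsCyclicVector 3 (c x))
    (hι : ∀ᶠ y in 𝓝 x, IsABLinear (ι y) ∧ Function.Injective (ι y)) :
    (∀ i, IsHolSeriesAt (fun y => t y i) x) ↔ ∃ g : Fin 3 → M → Cb,
      (∀ j, IsHolSeriesAt (g j) x) ∧
        ∀ᶠ y in 𝓝 x, ι y (t y) = ∑ j : Fin 3, g j y • aPow j (ι y (c y)) := by
  refine (IsHolSeriesAt.forall_iff_exists_mulVec (isHolSeriesAt_toMatrix_aPow hα hβ hγ hc)
    hcyc.isUnit_det_toMatrix).trans (exists_congr fun g => and_congr_right fun _ =>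
      eventually_congr (hι.mono fun y hy => ?_))
  rw [← hy.1.map_sum_smul_aPow (fun j => g j y), hy.2.eq_iff,
    ← toMatrix_themeBasis_mulVec]
  rfl

theorem isHolSeriesAt_embMatrix (hα : IsHolAt α x) (hβ : IsHolAt β x) (hγ : IsHolAt γ x)
    (k : ℕ) (i j : Fin 3) : IsHolSeriesAt
      (fun y => ((PowerSeries.X : Cb) ^ k • embMatrix (α y) (β y) (γ y)) i j) x := by
  have hb : ∀ n, IsHolSeriesAt (fun _ : M => bVar ^ n) x := fun n => .const _ x
  have hb1 : IsHolSeriesAt (fun _ : M => bVar) x := .const _ x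
  have hmul : ∀ {f : M → ℂ}, IsHolAt f x → ∀ n, IsHolSeriesAt (fun y => cst (f y) * bVar ^ n) x :=
    fun hf n => (IsHolSeriesAt.of_cst hf).mul (hb n)
  refine (IsHolSeriesAt.const _ x).mul ?_
  fin_cases i <;> fin_cases j
  · exact hb 2
  · exact (hmul hγ 3).sub hb1
  · exact ((IsHolSeriesAt.const _ x).sub ((IsHolSeriesAt.of_cst (hβ.sub hα)).mul hb1)).add
      (hmul (hα.mul hγ) 3)
  · exact .const 0 x
  · exact hmul hβ 2
  · exact (hmul hγ 2).sub ((IsHolSeriesAt.of_cst hβ).mul hb1)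
  · exact .const 0 x
  · exact .const 0 x
  · exact hmul (hα.mul hβ) 2

theorem isHolSeriesAt_themeEmb (Λ : Finset ℚ) (μ : ℚ) (k : ℕ) (hα : IsHolAt α x)
    (hβ : IsHolAt β x) (hγ : IsHolAt γ x) (hc : ∀ i, IsHolSeriesAt (fun y => c y i) x) (ν : Λ)
    (j : Fin 3) :
    IsHolSeriesAt (fun y => themeEmb lam Λ μ k (α y) (β y) (γ y) (c y) ν j) x := by
  simp only [themeEmb_apply]
  split_ifs
  · exact IsHolSeriesAt.mulVec (isHolSeriesAt_embMatrix hα hβ hγ k) hc j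
  · exact .const 0 x

theorem isHolSeriesAt_themeGen (lam : ℚ) (α β γ : M → ℂ) (x : M) (i : Fin 3) :
    IsHolSeriesAt (fun y => themeGen lam (α y) (β y) (γ y) i) x :=
  .const ((![0, 0, 1] : Fin 3 → Cb) i) x

theorem isThematicOn_themeEmb {μ : ℚ} (k : ℕ) {Λ : Finset ℚ} (hμ : μ ∈ Λ)
    (hα : ∀ x, IsHolAt α x) (hβ : ∀ x, IsHolAt β x) (hγ : ∀ x, IsHolAt γ x)
    (hα0 : ∀ x, α x ≠ 0) (hβ0 : ∀ x, β x ≠ 0) :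
    IsThematicOn 3 (fun x => themeEmb (μ + 2 + k) Λ μ k (α x) (β x) (γ x)
      (themeGen _ (α x) (β x) (γ x))) Set.univ := by
  let c := fun x => themeGen (μ + 2 + k) (α x) (β x) (γ x)
  have hc := isHolSeriesAt_themeGen (μ + 2 + k) α β γ
  have hcyc := fun x => isCyclicVector_themeGen (μ + 2 + k) (α x) (β x) (γ x)
  have hι := fun x => isABLinear_themeEmb Λ μ k (α x) (β x) (γ x)
  let C : M → Matrix (Fin 3) (Fin 3) Cb := fun x =>
    (themeBasis (μ + 2 + k) (α x) (β x) (γ x)).toMatrix fun j : Fin 3 => aPow j (c x)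
  let cube : M → Fin 3 → Cb := fun x =>
    (aPow 3 (c x) : CanonicalTheme (μ + 2 + k) (α x) (β x) (γ x))
  have hcube : ∀ x, (C x).mulVec ((C x)⁻¹.mulVec (cube x)) = cube x := fun x => by
    rw [Matrix.mulVec_mulVec, Matrix.mul_nonsing_inv _ (hcyc x).isUnit_det_toMatrix,
      Matrix.one_mulVec]
  refine ⟨fun x _ => isHolSeriesAt_themeEmb Λ μ k (hα x) (hβ x) (hγ x) (hc x), fun x _ => ?_,
    fun j x => (C x)⁻¹.mulVec (cube x) j, fun j x _ => ?_, fun x _ => ?_⟩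
  · simpa only [Function.comp_def, (hι x).map_aPow] using (hcyc x).1.map' _
      (LinearMap.ker_eq_bot.2 (themeEmb_injective _ hμ k (hα0 x) (hβ0 x) (γ x)))
  · exact IsHolSeriesAt.inv_mulVec (isHolSeriesAt_toMatrix_aPow (hα x) (hβ x) (hγ x) (hc x))
      (hcyc x).isUnit_det_toMatrix (isHolSeriesAt_aPow (hα x) (hβ x) (hγ x) (hc x) 3) j
  · have hsum := (toMatrix_themeBasis_mulVec (fun j : Fin 3 => aPow j (c x)) _).symm.trans (hcube x)
    rw [← (hι x).map_sum_smul_aPow, ← (hι x).map_aPow]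
    exact congrArg _ hsum.symm

theorem isHolFamily_canonicalFamily (hlam : 2 < lam) (hα : ∀ x, IsHolAt α x)
    (hβ : ∀ x, IsHolAt β x) (hγ : ∀ x, IsHolAt γ x) (hα0 : ∀ x, α x ≠ 0) (hβ0 : ∀ x, β x ≠ 0) :
    (canonicalFamily lam α β γ hα hβ hγ).IsHolFamily (fun _ : Fin 3 => lam) := by
  refine ⟨fun x => isThemeWithInvariants_canonicalTheme hlam (hα0 x) (hβ0 x) (γ x), fun _ => ?_⟩
  obtain ⟨μ, k, hpos, hle, rfl⟩ := exists_residue hlam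
  have hμ := Finset.mem_singleton_self μ
  have hcyc := fun x => isCyclicVector_themeGen (μ + 2 + k) (α x) (β x) (γ x)
  have hι := fun x => isABLinear_themeEmb {μ} μ k (α x) (β x) (γ x)
  have hinj := fun x => themeEmb_injective (μ + 2 + k) hμ k (hα0 x) (hβ0 x) (γ x)
  exact ⟨Set.univ, {μ}, _, isOpen_univ, trivial, by simp [hpos, hle],
    isThematicOn_themeEmb k hμ hα hβ hγ hα0 hβ0,
    fun x => themeEmb _ {μ} μ k (α x) (β x) (γ x), fun x _ => ⟨hι x, hinj x,
      (hι x).range_eq_span_aPow (hcyc x).2, fun _ =>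
        isHolSeriesAt_iff_exists_sum_aPow_map (hα x) (hβ x) (hγ x)
          (isHolSeriesAt_themeGen _ α β γ x) (hcyc x) (.of_forall fun y => ⟨hι y, hinj y⟩)⟩⟩

end Families

section LocalForm

open ReducedComplexSpace

section Parameters

/-- The parameter `α` of a canonical theme, read off the image `q` of a generator under
`embMatrix`; see `embParams_mulVec`. -/
noncomputable def embAlpha (q : Fin 3 → Cb) : ℂ :=
  -PowerSeries.coeff 2 (q 2) / PowerSeries.coeff 1 (q 1)

/-- The parameter `β` of a canonical theme, read off the image `q` of a generator under
`embMatrix`; see `embParams_mulVec`. -/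
noncomputable def embBeta (q : Fin 3 → Cb) : ℂ :=
  -PowerSeries.coeff 1 (q 1) / (2 * PowerSeries.coeff 0 (q 0))

/-- The parameter `γ` of a canonical theme, read off the image `q` of a generator under
`embMatrix`; see `embParams_mulVec`. -/
noncomputable def embGamma (q : Fin 3 → Cb) : ℂ :=
  (PowerSeries.coeff 2 (q 1) + embBeta q * PowerSeries.coeff 1 (q 0))
      / (2 * PowerSeries.coeff 0 (q 0))
    + embBeta q * PowerSeries.coeff 3 (q 2) / (2 * PowerSeries.coeff 2 (q 2))
    + embBeta q * (embBeta q - embAlpha q)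

variable {α β γ : ℂ} {c : Fin 3 → Cb}

theorem coeff_embMatrix_mulVec_zero (α β γ : ℂ) (c : Fin 3 → Cb) :
    PowerSeries.coeff 0 ((embMatrix α β γ).mulVec c 0) = 2⁻¹ * PowerSeries.constantCoeff (c 2) ∧
    PowerSeries.coeff 1 ((embMatrix α β γ).mulVec c 0) = -PowerSeries.constantCoeff (c 1)
      + 2⁻¹ * PowerSeries.coeff 1 (c 2) - (β - α) * PowerSeries.constantCoeff (c 2) := by
  constructor
  · simp [embMatrix, Matrix.mulVec, dotProduct, Fin.sum_univ_three, add_mul, sub_mul, mul_assoc]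
  · simp [embMatrix, Matrix.mulVec, dotProduct, Fin.sum_univ_three, add_mul, sub_mul, mul_assoc,
      PowerSeries.coeff_X_pow_mul', PowerSeries.coeff_succ_X_mul]
    ring

theorem coeff_embMatrix_mulVec_one (α β γ : ℂ) (c : Fin 3 → Cb) :
    PowerSeries.coeff 1 ((embMatrix α β γ).mulVec c 1) = -β * PowerSeries.constantCoeff (c 2) ∧
    PowerSeries.coeff 2 ((embMatrix α β γ).mulVec c 1) = β * PowerSeries.constantCoeff (c 1)
      + γ * PowerSeries.constantCoeff (c 2) - β * PowerSeries.coeff 1 (c 2) := by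
  constructor
  · simp [embMatrix, Matrix.mulVec, dotProduct, Fin.sum_univ_three, sub_mul, mul_assoc,
      PowerSeries.coeff_X_pow_mul', PowerSeries.coeff_succ_X_mul]
  · simp [embMatrix, Matrix.mulVec, dotProduct, Fin.sum_univ_three, sub_mul, mul_assoc,
      PowerSeries.coeff_X_pow_mul', PowerSeries.coeff_succ_X_mul]
    ring

theorem coeff_embMatrix_mulVec_two (α β γ : ℂ) (c : Fin 3 → Cb) :
    PowerSeries.coeff 2 ((embMatrix α β γ).mulVec c 2)
      = α * β * PowerSeries.constantCoeff (c 2) ∧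
    PowerSeries.coeff 3 ((embMatrix α β γ).mulVec c 2) = α * β * PowerSeries.coeff 1 (c 2) := by
  constructor <;>
    simp [embMatrix, Matrix.mulVec, dotProduct, Fin.sum_univ_three, mul_assoc,
      PowerSeries.coeff_X_pow_mul']

theorem embParams_mulVec (hα : α ≠ 0) (hβ : β ≠ 0) (γ : ℂ)
    (hc : PowerSeries.constantCoeff (c 2) ≠ 0) :
    embAlpha ((embMatrix α β γ).mulVec c) = α ∧ embBeta ((embMatrix α β γ).mulVec c) = β ∧
      embGamma ((embMatrix α β γ).mulVec c) = γ := by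
  obtain ⟨h00, h01⟩ := coeff_embMatrix_mulVec_zero α β γ c
  obtain ⟨h11, h12⟩ := coeff_embMatrix_mulVec_one α β γ c
  obtain ⟨h22, h23⟩ := coeff_embMatrix_mulVec_two α β γ c
  have hembα : embAlpha ((embMatrix α β γ).mulVec c) = α := by
    rw [embAlpha, h11, h22]
    field_simp
  have hembβ : embBeta ((embMatrix α β γ).mulVec c) = β := by
    rw [embBeta, h00, h11]
    field_simp
  refine ⟨hembα, hembβ, ?_⟩
  rw [embGamma, hembα, hembβ, h00, h01, h12, h22, h23]
  field_simp
  ring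

end Parameters

section Holomorphy

variable {M : Type u} [TopologicalSpace M] [ReducedComplexSpace M] {x : M}

section

variable {q : M → Fin 3 → Cb}

theorem isHolAt_embAlpha (hq : ∀ i, IsHolSeriesAt (fun y => q y i) x)
    (h1 : PowerSeries.coeff 1 (q x 1) ≠ 0) : IsHolAt (fun y => embAlpha (q y)) x :=
  ((hq 2).coeff 2).neg.div ((hq 1).coeff 1) h1

theorem isHolAt_embBeta (hq : ∀ i, IsHolSeriesAt (fun y => q y i) x)
    (h0 : PowerSeries.coeff 0 (q x 0) ≠ 0) : IsHolAt (fun y => embBeta (q y)) x :=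
  ((hq 1).coeff 1).neg.div ((isHolAt_const 2 x).mul ((hq 0).coeff 0))
    (mul_ne_zero two_ne_zero h0)

theorem isHolAt_embGamma (hq : ∀ i, IsHolSeriesAt (fun y => q y i) x)
    (h0 : PowerSeries.coeff 0 (q x 0) ≠ 0) (h1 : PowerSeries.coeff 1 (q x 1) ≠ 0)
    (h2 : PowerSeries.coeff 2 (q x 2) ≠ 0) : IsHolAt (fun y => embGamma (q y)) x := by
  have hβ := isHolAt_embBeta hq h0
  have htwo := isHolAt_const (2 : ℂ) x
  exact ((((hq 1).coeff 2).add (hβ.mul ((hq 0).coeff 1))).div (htwo.mul ((hq 0).coeff 0))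
    (mul_ne_zero two_ne_zero h0)).add ((hβ.mul ((hq 2).coeff 3)).div
      (htwo.mul ((hq 2).coeff 2)) (mul_ne_zero two_ne_zero h2)) |>.add
        (hβ.mul (hβ.sub (isHolAt_embAlpha hq h1)))

end

variable {α β γ : M → ℂ} {c : M → Fin 3 → Cb}

theorem isHolAt_of_embMatrix_mulVec
    (h0 : ∀ᶠ y in 𝓝 x, α y ≠ 0 ∧ β y ≠ 0 ∧ PowerSeries.constantCoeff (c y 2) ≠ 0)
    (hq : ∀ i, IsHolSeriesAt (fun y => (embMatrix (α y) (β y) (γ y)).mulVec (c y) i) x) :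
    IsHolAt α x ∧ IsHolAt β x ∧ IsHolAt γ x := by
  obtain ⟨hα, hβ, hc⟩ := h0.self_of_nhds
  have hq0 : PowerSeries.coeff 0 ((embMatrix (α x) (β x) (γ x)).mulVec (c x) 0) ≠ 0 := by
    rw [(coeff_embMatrix_mulVec_zero _ _ _ _).1]
    exact mul_ne_zero (inv_ne_zero two_ne_zero) hc
  have hq1 : PowerSeries.coeff 1 ((embMatrix (α x) (β x) (γ x)).mulVec (c x) 1) ≠ 0 := by
    rw [(coeff_embMatrix_mulVec_one _ _ _ _).1]
    exact mul_ne_zero (neg_ne_zero.2 hβ) hc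
  have hq2 : PowerSeries.coeff 2 ((embMatrix (α x) (β x) (γ x)).mulVec (c x) 2) ≠ 0 := by
    rw [(coeff_embMatrix_mulVec_two _ _ _ _).1]
    exact mul_ne_zero (mul_ne_zero hα hβ) hc
  have hparams := h0.mono fun y hy => embParams_mulVec hy.1 hy.2.1 (γ y) hy.2.2
  exact ⟨(isHolAt_embAlpha hq hq1).congr (hparams.mono fun _ hy => hy.1),
    (isHolAt_embBeta hq hq0).congr (hparams.mono fun _ hy => hy.2.1),
    (isHolAt_embGamma hq hq0 hq1 hq2).congr (hparams.mono fun _ hy => hy.2.2)⟩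

theorem isHolSeriesAt_embMatrix_mulVec_iff (hα : IsHolAt α x) (hβ : IsHolAt β x)
    (hγ : IsHolAt γ x) (hα0 : α x ≠ 0) (hβ0 : β x ≠ 0) :
    (∀ i, IsHolSeriesAt (fun y => (embMatrix (α y) (β y) (γ y)).mulVec (c y) i) x) ↔
      ∀ i, IsHolSeriesAt (fun y => c y i) x := by
  refine IsHolSeriesAt.mulVec_iff (n := 6) (D := fun y => cst (α y * β y ^ 2)) (fun i j => ?_)
    (.of_cst ?_) (.of_forall fun y => det_embMatrix (α y) (β y) (γ y)) ?_
  · simpa using isHolSeriesAt_embMatrix hα hβ hγ 0 i j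
  · simpa only [pow_two] using hα.mul (hβ.mul hβ)
  · simpa using And.intro hα0 hβ0

/-- `Θ` identifies over `U` the canonical themes with parameters `α`, `β`, `γ`, holomorphic on
`U`, with the family `ℍ`. -/
def ABFamily.IsCanonicalFormOn (ℍ : ABFamily.{u, w} M) {lam : ℚ} {α β γ : M → ℂ}
    (Θ : ∀ y, CanonicalTheme lam (α y) (β y) (γ y) →ₗ[Cb] ℍ.fib y) (U : Set M) : Prop :=
  ∀ y ∈ U, (ReducedComplexSpace.IsHolAt α y ∧ ReducedComplexSpace.IsHolAt β y ∧
      ReducedComplexSpace.IsHolAt γ y ∧ α y ≠ 0 ∧ β y ≠ 0) ∧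
    IsABLinear (Θ y) ∧ Function.Bijective (Θ y) ∧
    ∀ t : ∀ y, CanonicalTheme lam (α y) (β y) (γ y),
      (∀ i, IsHolSeriesAt (fun z => t z i) y) ↔ ℍ.IsHolAt (fun z => Θ z (t z)) y

theorem exists_canonical_form {μ : ℚ} (hpos : 0 < μ) (hle : μ ≤ 1) {k : ℕ} {Λ : Finset ℚ}
    (hΛ : ∀ ν ∈ Λ, 0 < ν ∧ ν ≤ 1) {E : Type*} [AddCommGroup E] [Module Cb E] [ABModule E]
    (hE : HasFundamentalInvariants (fun _ : Fin 3 => μ + 2 + k) E) {θ : E →ₗ[Cb] Xi Λ 2}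
    (hθ : IsABLinear θ) (hinj : Function.Injective θ) {φ : Xi Λ 2}
    (hli : LinearIndependent Cb fun j : Fin 3 => aPow j φ)
    (hrange : LinearMap.range θ = Submodule.span Cb (Set.range fun j : Fin 3 => aPow j φ)) :
    μ ∈ Λ ∧ ∃ (α β γ : ℂ) (c : CanonicalTheme (μ + 2 + k) α β γ)
      (Θ : CanonicalTheme (μ + 2 + k) α β γ →ₗ[Cb] E), α ≠ 0 ∧ β ≠ 0 ∧ IsCyclicVector 3 c ∧
        themeEmb (μ + 2 + k) Λ μ k α β γ c = φ ∧ IsABLinear Θ ∧ Function.Bijective Θ ∧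
        ∀ v, θ (Θ v) = themeEmb (μ + 2 + k) Λ μ k α β γ v := by
  obtain ⟨e, rfl⟩ : φ ∈ LinearMap.range θ := hrange ▸ Submodule.subset_span ⟨0, rfl⟩
  obtain ⟨hμ, α, β, γ, hα, hβ, hemb⟩ := exists_range_eq_range_themeEmb hpos hle hΛ hE
    ⟨e, hθ.isCyclicVector_of_range_eq hinj hli hrange⟩ hθ hinj
  have hι := isABLinear_themeEmb Λ μ k α β γ
  have hιinj := themeEmb_injective (μ + 2 + k) hμ k hα hβ γ
  obtain ⟨Θ, hΘ, hbij, hlift⟩ := exists_bijective_lift_of_range_eq hι hθ hιinj hinj hemb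
  obtain ⟨c, rfl⟩ := hbij.2 e
  rw [hlift] at hli hrange
  exact ⟨hμ, α, β, γ, c, Θ, hα, hβ,
    hι.isCyclicVector_of_range_eq hιinj hli (hemb.trans hrange), (hlift c).symm, hΘ, hbij, hlift⟩

theorem isHolAt_of_themeEmb {lam μ : ℚ} {k : ℕ} {Λ : Finset ℚ} (hμ : μ ∈ Λ)
    {c : ∀ y, CanonicalTheme lam (α y) (β y) (γ y)}
    (h0 : ∀ᶠ y in 𝓝 x, α y ≠ 0 ∧ β y ≠ 0 ∧ IsCyclicVector 3 (c y))
    (hφ : ∀ ν j, IsHolSeriesAt (fun y => themeEmb lam Λ μ k (α y) (β y) (γ y) (c y) ν j) x) :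
    (IsHolAt α x ∧ IsHolAt β x ∧ IsHolAt γ x) ∧ ∀ i, IsHolSeriesAt (fun y => c y i) x := by
  have hq : ∀ i, IsHolSeriesAt (fun y => (embMatrix (α y) (β y) (γ y)).mulVec (c y) i) x :=
    fun i => .of_X_pow_mul (k := k) <| (hφ ⟨μ, hμ⟩ i).congr <| .of_forall fun y =>
      (congrFun (themeEmb_apply lam μ k _ _ _ (c y) ⟨μ, hμ⟩) i).trans <|
        (congrFun (if_pos rfl) i).trans (congrFun (Matrix.smul_mulVec _ _ _) i)
  simp only [isCyclicVector_canonicalTheme_iff] at h0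
  have hhol := isHolAt_of_embMatrix_mulVec h0 hq
  exact ⟨hhol, (isHolSeriesAt_embMatrix_mulVec_iff hhol.1 hhol.2.1 hhol.2.2
    h0.self_of_nhds.1 h0.self_of_nhds.2.1).1 hq⟩

theorem exists_isCanonicalFormOn {lam : ℚ} (hlam : 2 < lam) {ℍ : ABFamily.{u, w} M}
    (hH : ℍ.IsHolFamily (fun _ : Fin 3 => lam)) (x₀ : M) :
    ∃ (U : Set M) (α β γ : M → ℂ)
      (Θ : ∀ y, CanonicalTheme lam (α y) (β y) (γ y) →ₗ[Cb] ℍ.fib y),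
      IsOpen U ∧ x₀ ∈ U ∧ ℍ.IsCanonicalFormOn Θ U := by
  obtain ⟨μ, k, hpos, hle, rfl⟩ := exists_residue hlam
  obtain ⟨U, Λ, φ, hU, hx₀, hΛ, ⟨hφ, hli, -⟩, θ, hθ⟩ := hH.2 x₀
  have hform := fun y (hy : y ∈ U) => exists_canonical_form hpos hle hΛ (hH.1 y).2
    (hθ y hy).1 (hθ y hy).2.1 (hli y hy) (hθ y hy).2.2.1
  have hμ : μ ∈ Λ := (hform x₀ hx₀).1
  choose! α β γ c Θ hα hβ hc hcφ hΘ hbij hlift using fun y hy => (hform y hy).2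
  have hUn : ∀ y ∈ U, ∀ᶠ z in 𝓝 y, z ∈ U := fun y hy => hU.mem_nhds hy
  refine ⟨U, α, β, γ, Θ, hU, hx₀, fun y hy => ?_⟩
  obtain ⟨⟨hαy, hβy, hγy⟩, hcy⟩ := isHolAt_of_themeEmb (k := k) hμ
    ((hUn y hy).mono fun z hz => ⟨hα z hz, hβ z hz, hc z hz⟩) fun ν j =>
      (hφ y hy ν j).congr ((hUn y hy).mono fun z hz =>
        congrFun (congrFun (hcφ z hz).symm ν) j)
  refine ⟨⟨hαy, hβy, hγy, hα y hy, hβ y hy⟩, hΘ y hy, hbij y hy, fun t => ?_⟩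
  rw [isHolSeriesAt_iff_exists_sum_aPow_map (ι := fun z => themeEmb _ Λ μ k (α z) (β z) (γ z))
    hαy hβy hγy hcy (hc y hy) ((hUn y hy).mono fun z hz => ⟨isABLinear_themeEmb Λ μ k _ _ _,
      themeEmb_injective _ hμ k (hα z hz) (hβ z hz) _⟩), (hθ y hy).2.2.2]
  refine exists_congr fun g => and_congr_right fun _ =>
    eventually_congr ((hUn y hy).mono fun z hz => ?_)
  rw [hlift z hz, hcφ z hz]

end Holomorphy

end LocalForm

section Pullback

open ReducedComplexSpace

section Map

variable {M : Type u} [TopologicalSpace M] [ReducedComplexSpace M]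
  {N : Type v} [TopologicalSpace N] [ReducedComplexSpace N] {f : N → M} {U : Set N} {y : N}

theorem IsHolMapOn.continuousAt (hf : IsHolMapOn f U) (hU : IsOpen U) (hy : y ∈ U) :
    ContinuousAt f y :=
  hf.1.continuousAt (hU.mem_nhds hy)

theorem IsHolMapOn.isHolSeriesAt_comp (hf : IsHolMapOn f U) (hU : IsOpen U) (hy : y ∈ U)
    {S : M → Cb} (hS : IsHolSeriesAt S (f y)) : IsHolSeriesAt (fun z => S (f z)) y := by
  filter_upwards [(hf.continuousAt hU hy).eventually hS, hU.mem_nhds hy] with z hz hzU n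
  exact hf.2 z hzU _ (hz n)

theorem IsHolMapOn.comp {L : Type*} [TopologicalSpace L] [ReducedComplexSpace L] {g : L → N}
    {V : Set L} (hf : IsHolMapOn f U) (hg : IsHolMapOn g V) :
    IsHolMapOn (f ∘ g) (V ∩ g ⁻¹' U) :=
  ⟨hf.1.comp (hg.1.mono Set.inter_subset_left) fun _ hz => hz.2,
    fun z hz φ hφ => hg.2 z hz.1 _ (hf.2 (g z) hz.2 φ hφ)⟩

end Map

section Sections

variable {M : Type u} [TopologicalSpace M] [ReducedComplexSpace M]
  {N : Type v} [TopologicalSpace N] [ReducedComplexSpace N]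
  {𝔼 : ABFamily.{u, w} M} {f : N → M} {y : N}

theorem ABFamily.IsHolAt.congr {t t' : ∀ x, 𝔼.fib x} {x : M} (ht : 𝔼.IsHolAt t x)
    (h : ∀ᶠ z in 𝓝 x, t z = t' z) : 𝔼.IsHolAt t' x := by
  obtain ⟨U, k, s, -, hx, hs⟩ := 𝔼.exists_frame x
  obtain ⟨g, hg, htg⟩ := ((hs x hx).2 t).1 ht
  exact ((hs x hx).2 t').2 ⟨g, hg, (h.and htg).mono fun z hz => hz.1.symm.trans hz.2⟩

theorem ABFamily.IsHolAt.isPullbackHolAt_comp {s : ∀ x, 𝔼.fib x} (hs : 𝔼.IsHolAt s (f y)) :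
    𝔼.IsPullbackHolAt f (fun z => s (f z)) y :=
  ⟨1, fun _ => s, fun _ _ => 1, fun _ => hs, fun _ => IsHolSeriesAt.const 1 y,
    .of_forall fun _ => by simp⟩

namespace ABFamily.IsPullbackHolAt

variable {t t' : ∀ y, 𝔼.fib (f y)}

theorem congr (ht : 𝔼.IsPullbackHolAt f t y) (h : ∀ᶠ z in 𝓝 y, t z = t' z) :
    𝔼.IsPullbackHolAt f t' y := by
  obtain ⟨n, s, g, hs, hg, hsum⟩ := ht
  exact ⟨n, s, g, hs, hg, (h.and hsum).mono fun z hz => hz.1.symm.trans hz.2⟩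

theorem add (ht : 𝔼.IsPullbackHolAt f t y) (ht' : 𝔼.IsPullbackHolAt f t' y) :
    𝔼.IsPullbackHolAt f (fun z => t z + t' z) y := by
  obtain ⟨n, s, g, hs, hg, h⟩ := ht
  obtain ⟨n', s', g', hs', hg', h'⟩ := ht'
  refine ⟨n + n', Fin.append s s', Fin.append g g', ?_, ?_, ?_⟩
  · exact Fin.addCases (by simpa only [Fin.append_left]) (by simpa only [Fin.append_right])
  · exact Fin.addCases (by simpa only [Fin.append_left]) (by simpa only [Fin.append_right])
  · filter_upwards [h, h'] with z hz hz'
    simp only [hz, hz', Fin.sum_univ_add, Fin.append_left, Fin.append_right]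

theorem smul (ht : 𝔼.IsPullbackHolAt f t y) {S : N → Cb} (hS : IsHolSeriesAt S y) :
    𝔼.IsPullbackHolAt f (fun z => S z • t z) y := by
  obtain ⟨n, s, g, hs, hg, h⟩ := ht
  refine ⟨n, s, fun i z => S z * g i z, hs, fun i => hS.mul (hg i), h.mono fun z hz => ?_⟩
  simp only [hz, Finset.smul_sum, smul_smul]

theorem sum {ι : Type*} (A : Finset ι) {t : ι → ∀ y, 𝔼.fib (f y)}
    (ht : ∀ i, 𝔼.IsPullbackHolAt f (t i) y) :
    𝔼.IsPullbackHolAt f (fun z => ∑ i ∈ A, t i z) y := by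
  classical
  induction A using Finset.induction_on with
  | empty => exact ⟨0, Fin.elim0, Fin.elim0, Fin.rec0, Fin.rec0, .of_forall fun _ => by simp⟩
  | insert a A ha ih =>
    simp only [Finset.sum_insert ha]
    exact (ht a).add ih

theorem comp {L : Type*} [TopologicalSpace L] [ReducedComplexSpace L] {g : L → N} {V : Set L}
    {z : L} (hg : IsHolMapOn g V) (hV : IsOpen V) (hz : z ∈ V)
    (ht : 𝔼.IsPullbackHolAt f t (g z)) : 𝔼.IsPullbackHolAt (f ∘ g) (fun z => t (g z)) z := by
  obtain ⟨n, s, c, hs, hc, hsum⟩ := ht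
  exact ⟨n, s, fun i z => c i (g z), hs, fun i => hg.isHolSeriesAt_comp hV hz (hc i),
    (hg.continuousAt hV hz).eventually hsum⟩

end ABFamily.IsPullbackHolAt

end Sections

section Classifying

variable {M : Type u} [TopologicalSpace M] [ReducedComplexSpace M]
  {N : Type v} [TopologicalSpace N] [ReducedComplexSpace N] {L : Type*} [TopologicalSpace L]
  [ReducedComplexSpace L] {𝔼 : ABFamily.{u, w} M} {ℍ : ABFamily.{v, w'} N} {f : N → M}

theorem isPullbackHolAt_comp_iff {U : Set N} (hU : IsOpen U) {θ : ∀ y, 𝔼.fib (f y) →ₗ[Cb] ℍ.fib y}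
    (hθ : ∀ y ∈ U, IsABLinear (θ y) ∧ Function.Bijective (θ y) ∧
      ∀ t, 𝔼.IsPullbackHolAt f t y ↔ ℍ.IsHolAt (fun z => θ z (t z)) y)
    {g : L → N} {V : Set L} (hg : IsHolMapOn g V) (hV : IsOpen V) {z : L} (hz : z ∈ V)
    (hgz : g z ∈ U) (t : ∀ z, 𝔼.fib (f (g z))) :
    𝔼.IsPullbackHolAt (f ∘ g) t z ↔ ℍ.IsPullbackHolAt g (fun z => θ (g z) (t z)) z := by
  have hUz : ∀ᶠ z' in 𝓝 z, g z' ∈ U := (hg.continuousAt hV hz).eventually (hU.mem_nhds hgz)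
  constructor
  · rintro ⟨n, s, c, hs, hc, ht⟩
    refine ⟨n, fun i y => θ y (s i (f y)), c, fun i => ?_, hc, ht.mono fun z' hz' => ?_⟩
    · exact ((hθ _ hgz).2.2 _).1 (ABFamily.IsHolAt.isPullbackHolAt_comp (f := f) (hs i))
    · simp only [hz', map_sum, map_smul, Function.comp_apply]
  · rintro ⟨n, s, c, hs, hc, ht⟩
    choose! τ hτ using fun i y hy => (hθ y hy).2.1.2 (s i y)
    have hτhol : ∀ i, 𝔼.IsPullbackHolAt f (τ i) (g z) := fun i => ((hθ _ hgz).2.2 _).2 <|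
      (hs i).congr (Eventually.mono (hU.mem_nhds hgz) fun y hy => (hτ i y hy).symm)
    refine (ABFamily.IsPullbackHolAt.sum Finset.univ fun i =>
      ((hτhol i).comp hg hV hz).smul (hc i)).congr ?_
    filter_upwards [ht, hUz] with z' hz' hUz'
    apply (hθ _ hUz').2.1.1
    simp only [hz', map_sum, map_smul, hτ _ _ hUz', Function.comp_apply]

theorem IsClassifyingMapAt.comp {𝕂 : ABFamily L} {x₀ : M} {y₀ : N} {z₀ : L} {g : L → N}
    (hf : IsClassifyingMapAt 𝔼 x₀ ℍ y₀ f) (hg : IsClassifyingMapAt ℍ y₀ 𝕂 z₀ g) :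
    IsClassifyingMapAt 𝔼 x₀ 𝕂 z₀ (f ∘ g) := by
  obtain ⟨rfl, U, hU, hy, hfU, θ, hθ⟩ := hf
  obtain ⟨rfl, V, hV, hz, hgV, η, hη⟩ := hg
  refine ⟨rfl, V ∩ g ⁻¹' U, hgV.1.isOpen_inter_preimage hV hU, ⟨hz, hy⟩, hfU.comp hgV,
    fun z => η z ∘ₗ θ (g z), fun z hzV => ⟨(hθ _ hzV.2).1.comp (hη z hzV.1).1,
      (hη z hzV.1).2.1.comp (hθ _ hzV.2).2.1, fun t => ?_⟩⟩
  exact (isPullbackHolAt_comp_iff hU hθ hgV hV hzV.1 hzV.2 t).trans ((hη z hzV.1).2.2 _)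

theorem IsClassifyingMapAt.eventually_abIsomorphic {x₀ : M} {y₀ : N}
    (hf : IsClassifyingMapAt 𝔼 x₀ ℍ y₀ f) :
    ∀ᶠ y in 𝓝 y₀, ABIsomorphic (𝔼.fib (f y)) (ℍ.fib y) := by
  obtain ⟨-, U, hU, hy, -, θ, hθ⟩ := hf
  filter_upwards [hU.mem_nhds hy] with y hy using ⟨θ y, (hθ y hy).1, (hθ y hy).2.1⟩

end Classifying

section Canonical

variable {M : Type u} [TopologicalSpace M] [ReducedComplexSpace M]
  {N : Type v} [TopologicalSpace N] [ReducedComplexSpace N] {lam : ℚ} {α β γ : M → ℂ}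

theorem isPullbackHolAt_canonicalFamily (hα : ∀ x, IsHolAt α x) (hβ : ∀ x, IsHolAt β x)
    (hγ : ∀ x, IsHolAt γ x) {f : N → M} {U : Set N} (hf : IsHolMapOn f U) (hU : IsOpen U)
    {y : N} (hy : y ∈ U) (t : ∀ y, CanonicalTheme lam (α (f y)) (β (f y)) (γ (f y))) :
    (canonicalFamily lam α β γ hα hβ hγ).IsPullbackHolAt f t y
      ↔ ∀ i, IsHolSeriesAt (fun z => t z i) y := by
  constructor
  · rintro ⟨n, s, g, hs, hg, ht⟩ i
    refine (IsHolSeriesAt.sum Finset.univ fun l _ =>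
      (hg l).mul (hf.isHolSeriesAt_comp hU hy (hs l i))).congr (ht.mono fun z hz => ?_)
    exact ((congrFun hz i).trans (Finset.sum_apply (M := fun _ : Fin 3 => Cb) i Finset.univ
      fun l => g l z • s l (f z))).symm
  · refine fun ht => ⟨3, fun i x => themeBasis lam (α x) (β x) (γ x) i, fun i z => t z i,
      fun i l => .const _ _, ht, .of_forall fun z => ?_⟩
    exact ((themeBasis lam (α (f z)) (β (f z)) (γ (f z))).sum_repr (t z)).symm

theorem isCanonicalFormOn_id (hα : ∀ x, IsHolAt α x) (hβ : ∀ x, IsHolAt β x)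
    (hγ : ∀ x, IsHolAt γ x) (hα0 : ∀ x, α x ≠ 0) (hβ0 : ∀ x, β x ≠ 0) :
    (canonicalFamily lam α β γ hα hβ hγ).IsCanonicalFormOn (lam := lam) (α := α) (β := β) (γ := γ)
      (fun _ => LinearMap.id) Set.univ :=
  fun y _ => ⟨⟨hα y, hβ y, hγ y, hα0 y, hβ0 y⟩, fun _ => rfl, Function.bijective_id,
    fun _ => Iff.rfl⟩

theorem isHolSeriesAt_homMatrix {α γ γ' c k l : N → ℂ} {y : N} (hα : IsHolAt α y)
    (hγ : IsHolAt γ y) (hγ' : IsHolAt γ' y) (hc : IsHolAt c y) (hk : IsHolAt k y)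
    (hl : IsHolAt l y) (i j : Fin 3) :
    IsHolSeriesAt (fun z => homMatrix (α z) (γ z) (γ' z) (c z) (k z) (l z) i j) y := by
  have hb : IsHolSeriesAt (fun _ : N => bVar) y := .const _ y
  have h0 : IsHolSeriesAt (fun _ : N => (0 : Cb)) y := .const _ y
  have h01 := (IsHolSeriesAt.of_cst hk).add ((IsHolSeriesAt.of_cst ((hγ.sub hγ').mul hc)).mul hb)
  have h02 := (IsHolSeriesAt.of_cst hl).add
    ((IsHolSeriesAt.of_cst (((hα.mul (hγ.sub hγ')).mul hc).sub (hγ'.mul hk))).mul hb)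
  fin_cases i <;> fin_cases j
  exacts [.of_cst hc, h01, h02, h0, .of_cst hc, .of_cst hk, h0, h0, .of_cst hc]

theorem isHolSeriesAt_shearMap_iff {α β γ α' β' γ' x : N → ℂ} {y : N} (hα : IsHolAt α y)
    (hγ : IsHolAt γ y) (hγ' : IsHolAt γ' y) (hx : IsHolAt x y)
    (t : ∀ y, CanonicalTheme lam (α y) (β y) (γ y)) :
    (∀ i, IsHolSeriesAt
      (fun z => shearMap lam (α z) (β z) (γ z) (α' z) (β' z) (γ' z) (x z) (t z) i) y) ↔
      ∀ i, IsHolSeriesAt (fun z => t z i) y :=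
  IsHolSeriesAt.mulVec_iff (n := 0) (D := fun _ => 1)
    (A := fun z => homMatrix (α z) (γ z) (γ' z) 1 (x z) 0)
    (isHolSeriesAt_homMatrix hα hγ hγ' (isHolAt_const 1 y) hx (isHolAt_const 0 y)) (.const 1 y)
    (.of_forall fun z => by simp [det_homMatrix]) (by simp)

theorem ABFamily.IsCanonicalFormOn.isClassifyingMapAt {ℍ : ABFamily.{v, w} N}
    {α' β' γ' : N → ℂ} {Θ : ∀ y, CanonicalTheme lam (α' y) (β' y) (γ' y) →ₗ[Cb] ℍ.fib y}
    {U : Set N} (hΘ : ℍ.IsCanonicalFormOn Θ U) (hU : IsOpen U) {y₀ : N} (hy₀ : y₀ ∈ U)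
    (hα : ∀ x, ReducedComplexSpace.IsHolAt α x) (hβ : ∀ x, ReducedComplexSpace.IsHolAt β x)
    (hγ : ∀ x, ReducedComplexSpace.IsHolAt γ x) {f : N → M} (hf : IsHolMapOn f U) {x : N → ℂ}
    (hx : ∀ y ∈ U, ReducedComplexSpace.IsHolAt x y) (hfα : ∀ y ∈ U, α' y = α (f y))
    (hfβ : ∀ y ∈ U, β' y = β (f y))
    (hfγ : ∀ y ∈ U, x y * (β (f y) - α (f y)) = γ (f y) - γ' y) :
    IsClassifyingMapAt (canonicalFamily lam α β γ hα hβ hγ) (f y₀) ℍ y₀ f := by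
  refine ⟨rfl, U, hU, hy₀, hf, fun y => Θ y ∘ₗ
    shearMap lam (α (f y)) (β (f y)) (γ (f y)) (α' y) (β' y) (γ' y) (x y), fun y hy => ?_⟩
  obtain ⟨⟨-, -, hγ', -⟩, hlin, hbij, hhol⟩ := hΘ y hy
  refine ⟨(isABLinear_shearMap (hfα y hy) (hfβ y hy) (hfγ y hy)).comp hlin,
    hbij.comp (shearMap_bijective ..), fun t => ?_⟩
  calc (canonicalFamily lam α β γ hα hβ hγ).IsPullbackHolAt f t y
      ↔ ∀ i, IsHolSeriesAt (fun z => t z i) y :=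
        isPullbackHolAt_canonicalFamily hα hβ hγ hf hU hy t
    _ ↔ ∀ i, IsHolSeriesAt (fun z => shearMap lam (α (f z)) (β (f z)) (γ (f z)) (α' z) (β' z)
          (γ' z) (x z) (t z) i) y :=
        (isHolSeriesAt_shearMap_iff (hf.2 y hy _ (hα _)) (hf.2 y hy _ (hγ _)) hγ' (hx y hy) t).symm
    _ ↔ ℍ.IsHolAt (fun z => Θ z (shearMap lam (α (f z)) (β (f z)) (γ (f z)) (α' z) (β' z)
          (γ' z) (x z) (t z))) y := hhol _

end Canonical

end Pullback

section OpenSubsets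

open ReducedComplexSpace

variable {M : Type u} [TopologicalSpace M] {n : ℕ}

theorem eventually_nhds_subtype_univ_iff {x : (Set.univ : Set M)} {P : M → Prop} :
    (∀ᶠ z in 𝓝 (x : M), P z) ↔ ∀ᶠ z : (Set.univ : Set M) in 𝓝 x, P z := by
  rw [← map_nhds_subtype_coe_eq_nhds x.2 univ_mem, eventually_map]

/-- The complex structure on a space identified by `j` with an open subset of `ℂⁿ`. -/
@[reducible] noncomputable def ReducedComplexSpace.ofOpenEmbedding (j : M → Fin n → ℂ)
    (hj : IsOpenEmbedding j) : ReducedComplexSpace M where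
  t2 := hj.isEmbedding.t2Space
  IsHolAt f x := ∃ G : (Fin n → ℂ) → ℂ, AnalyticAt ℂ G (j x) ∧ ∀ᶠ z in 𝓝 x, f z = G (j z)
  exists_chart x := ⟨Set.univ, n, 0, Set.range j, Fin.elim0, isOpen_univ, trivial,
    hj.isOpen_range, fun i => i.elim0, ((Homeomorph.Set.univ M).trans
      hj.isEmbedding.toHomeomorph).trans (Homeomorph.setCongr (by ext; simp)),
    fun _ _ => exists_congr fun _ => and_congr Iff.rfl eventually_nhds_subtype_univ_iff⟩

theorem isSmoothOfDim_ofOpenEmbedding (j : M → Fin n → ℂ) (hj : IsOpenEmbedding j) :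
    letI := ReducedComplexSpace.ofOpenEmbedding j hj
    IsSmoothOfDim n M :=
  fun _ => ⟨Set.univ, Set.range j, isOpen_univ, trivial, hj.isOpen_range,
    (Homeomorph.Set.univ M).trans hj.isEmbedding.toHomeomorph,
    fun _ _ => exists_congr fun _ => and_congr Iff.rfl eventually_nhds_subtype_univ_iff⟩

theorem isHolMapOn_ofOpenEmbedding {N : Type v} [TopologicalSpace N] [ReducedComplexSpace N]
    {j : M → Fin n → ℂ} (hj : IsOpenEmbedding j) {p : N → M} {U : Set N}
    (hp : ∀ y ∈ U, ∀ i, IsHolAt (fun z => j (p z) i) y) :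
    letI := ReducedComplexSpace.ofOpenEmbedding j hj
    IsHolMapOn p U := by
  have hcont : ∀ y ∈ U, ContinuousAt p y := fun y hy =>
    hj.isInducing.continuousAt_iff.2 (continuousAt_pi.2 fun i => (hp y hy i).continuousAt)
  refine ⟨fun y hy => (hcont y hy).continuousWithinAt, fun y hy g ⟨G, hG, hgG⟩ => ?_⟩
  exact (isHolAt_comp_analyticAt (hp y hy) hG).congr
    (((hcont y hy).eventually hgG).mono fun _ hz => hz.symm)

end OpenSubsets

section NonUniversality

open ReducedComplexSpace

/-- The standard complex structure on `ℂ²`, the base of the families which contradict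
universality. -/
noncomputable instance planeComplexSpace : ReducedComplexSpace (Fin 2 → ℂ) :=
  ReducedComplexSpace.ofOpenEmbedding id IsOpenEmbedding.id

theorem isHolAt_plane_iff {f : (Fin 2 → ℂ) → ℂ} {x : Fin 2 → ℂ} :
    IsHolAt f x ↔ AnalyticAt ℂ f x :=
  ⟨fun ⟨_, hG, h⟩ => hG.congr (h.mono fun _ hz => hz.symm),
    fun h => ⟨f, h, .of_forall fun _ => rfl⟩⟩

theorem isHolAt_plane_coord (i : Fin 2) (x : Fin 2 → ℂ) :
    IsHolAt (fun z : Fin 2 → ℂ => z i) x :=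
  isHolAt_plane_iff.2 (analyticAt_coord i x)

theorem isHolAt_plane_exp (x : Fin 2 → ℂ) :
    IsHolAt (fun z : Fin 2 → ℂ => Complex.exp (z 0)) x :=
  (isHolAt_plane_coord 0 x).comp_analyticAt analyticAt_cexp

/-- A chart of the blow-up of `0` in `ℂ²` along the first coordinate `s`, up to the unit
`(e^s - 1) / s`. -/
noncomputable def expBlowup (z : Fin 2 → ℂ) : Fin 2 → ℂ :=
  ![z 0, z 1 * (Complex.exp (z 0) - 1)]

/-- The projection of `ℂ²` onto its first axis. -/
def axisProj (z : Fin 2 → ℂ) : Fin 2 → ℂ :=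
  ![z 0, 0]

theorem isHolMapOn_expBlowup : IsHolMapOn expBlowup Set.univ :=
  isHolMapOn_ofOpenEmbedding .id fun y _ => Fin.forall_fin_two.2 ⟨isHolAt_plane_coord 0 y,
    (isHolAt_plane_coord 1 y).mul ((isHolAt_plane_exp y).sub (isHolAt_const 1 y))⟩

theorem isHolMapOn_axisProj : IsHolMapOn axisProj Set.univ :=
  isHolMapOn_ofOpenEmbedding .id fun y _ => Fin.forall_fin_two.2 ⟨isHolAt_plane_coord 0 y,
    isHolAt_const 0 y⟩

theorem continuous_axisProj : Continuous axisProj :=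
  continuousOn_univ.1 isHolMapOn_axisProj.1

theorem axisProj_zero : axisProj 0 = 0 := by
  ext i
  fin_cases i <;> rfl

theorem expBlowup_zero : expBlowup 0 = 0 := by
  ext i
  fin_cases i <;> simp [expBlowup]

theorem axisProj_single_one (t : ℂ) : axisProj (Pi.single 1 t) = 0 := by
  ext i
  fin_cases i <;> simp [axisProj]

theorem eventually_exists_expBlowup_eq {P : (Fin 2 → ℂ) → Prop} {x : Fin 2 → ℂ}
    (hx : Complex.exp (x 0) ≠ 1) (hx1 : x 1 = 0) (hP : ∀ᶠ z in 𝓝 x, P z) :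
    ∀ᶠ z in 𝓝 x, ∃ w, P w ∧ expBlowup w = z ∧ axisProj w = axisProj z := by
  have hexp : ContinuousAt (fun z : Fin 2 → ℂ => Complex.exp (z 0) - 1) x :=
    ((continuous_apply 0).cexp.sub continuous_const).continuousAt
  have hlift : Tendsto (fun z : Fin 2 → ℂ => ![z 0, z 1 / (Complex.exp (z 0) - 1)]) (𝓝 x)
      (𝓝 x) := by
    refine tendsto_pi_nhds.2 (Fin.forall_fin_two.2 ⟨(continuous_apply 0).tendsto x, ?_⟩)
    simpa [hx1, Pi.div_def] using ((continuous_apply 1).tendsto x).div hexp (sub_ne_zero.2 hx)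
  filter_upwards [hexp.eventually_ne (sub_ne_zero.2 hx), hlift.eventually hP] with z hz hPz
  refine ⟨_, hPz, ?_, rfl⟩
  ext i
  fin_cases i
  · rfl
  · exact div_mul_cancel₀ (z 1) hz

theorem exists_single_of_eventually {P : (Fin 2 → ℂ) → Prop} {Q : ℂ → Prop} (i : Fin 2)
    (hP : ∀ᶠ z in 𝓝 0, P z) (hQ : ∀ᶠ s in 𝓝[≠] 0, Q s) : ∃ s, Q s ∧ P (Pi.single i s) :=
  (hQ.and ((((continuous_single i).tendsto' 0 0 (Pi.single_zero i)).eventually hP).filter_mono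
    nhdsWithin_le_nhds)).exists

theorem eventuallyEq_comp_axisProj_of_analyticAt {h : (Fin 2 → ℂ) → ℂ} (hh : AnalyticAt ℂ h 0)
    (heq : h ∘ expBlowup =ᶠ[𝓝 0] h ∘ axisProj) : h =ᶠ[𝓝 0] h ∘ axisProj := by
  have hproj : AnalyticAt ℂ (h ∘ axisProj) 0 := isHolAt_plane_iff.1 <|
    isHolMapOn_axisProj.2 0 trivial h (isHolAt_plane_iff.2 (axisProj_zero.symm ▸ hh))
  obtain ⟨ε, hε, hball⟩ := Metric.eventually_nhds_iff_ball.1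
    (hh.eventually_analyticAt.and (hproj.eventually_analyticAt.and heq))
  have hexp : ∀ᶠ s : ℂ in 𝓝[≠] 0, Complex.exp s ≠ 1 :=
    (Complex.hasDerivAt_exp 0).eventually_ne (by simp)
  obtain ⟨s, hs, hsmem⟩ := exists_single_of_eventually 0 (Metric.ball_mem_nhds 0 hε) hexp
  have hnear : h =ᶠ[𝓝 (Pi.single 0 s)] h ∘ axisProj := by
    filter_upwards [eventually_exists_expBlowup_eq (by simpa using hs) (by simp)
      (Metric.isOpen_ball.mem_nhds hsmem)]
    rintro z ⟨w, hw, hwz, hproj⟩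
    simpa only [Function.comp_apply, hwz, hproj] using (hball w hw).2.2
  have hA : AnalyticOnNhd ℂ h (Metric.ball 0 ε) := fun z hz => (hball z hz).1
  have hB : AnalyticOnNhd ℂ (h ∘ axisProj) (Metric.ball 0 ε) := fun z hz => (hball z hz).2.1
  exact (hA.eqOn_of_preconnected_of_eventuallyEq hB (convex_ball 0 ε).isPreconnected hsmem
    hnear).eventuallyEq_of_mem (Metric.ball_mem_nhds 0 hε)

theorem eventuallyEq_comp_axisProj {M : Type u} [TopologicalSpace M] [ReducedComplexSpace M]
    {f : (Fin 2 → ℂ) → M} {U : Set (Fin 2 → ℂ)} (hf : IsHolMapOn f U) (hU : IsOpen U)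
    (h0 : 0 ∈ U) (heq : f ∘ expBlowup =ᶠ[𝓝 0] f ∘ axisProj) : f =ᶠ[𝓝 0] f ∘ axisProj := by
  obtain ⟨W, n, g, hW, hfW, hg, hsep⟩ := exists_isHolAt_separating (f 0)
  have hmem : ∀ᶠ z in 𝓝 0, f z ∈ W := (hf.continuousAt hU h0).eventually (hW.mem_nhds hfW)
  have hmemproj : ∀ᶠ z in 𝓝 0, f (axisProj z) ∈ W :=
    continuous_axisProj.continuousAt.eventually (by rwa [axisProj_zero])
  have hcoord : ∀ᶠ z in 𝓝 0, ∀ i, g i (f z) = g i (f (axisProj z)) :=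
    eventually_all.2 fun i => eventuallyEq_comp_axisProj_of_analyticAt (h := g i ∘ f)
      (isHolAt_plane_iff.1 (hf.2 0 h0 (g i) (hg i _ hfW))) (heq.fun_comp (g i))
  filter_upwards [hmem, hmemproj, hcoord] with z hz hzproj hgz
  exact hsep _ hz _ hzproj hgz

theorem isHolAt_plane_mul_exp (α : ℂ) (x : Fin 2 → ℂ) :
    IsHolAt (fun z : Fin 2 → ℂ => α * Complex.exp (z 0)) x :=
  (isHolAt_const α x).mul (isHolAt_plane_exp x)

/-- The family over `ℂ²` with fibers `E(α, α e^s, δ(s,t))`; over the line `s = 0` they are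
the themes `E(α,α,δ)`, whose canonical form is unique. -/
noncomputable def planeFamily (lam : ℚ) (α : ℂ) (δ : (Fin 2 → ℂ) → ℂ) (hδ : ∀ z, IsHolAt δ z) :
    ABFamily.{0, 0} (Fin 2 → ℂ) :=
  canonicalFamily lam (fun _ => α) (fun z => α * Complex.exp (z 0)) δ (isHolAt_const α)
    (isHolAt_plane_mul_exp α) hδ

variable {lam : ℚ} {α : ℂ} {δ δ' : (Fin 2 → ℂ) → ℂ} {hδ : ∀ z, IsHolAt δ z}
  {hδ' : ∀ z, IsHolAt δ' z}

theorem isHolFamily_planeFamily (hlam : 2 < lam) (hα : α ≠ 0) :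
    (planeFamily lam α δ hδ).IsHolFamily (fun _ : Fin 3 => lam) :=
  isHolFamily_canonicalFamily hlam _ _ _ (fun _ => hα)
    fun _ => mul_ne_zero hα (Complex.exp_ne_zero _)

theorem abIsomorphic_planeFamily_iff {z : Fin 2 → ℂ} {γ : ℂ} (hz : z 0 = 0) :
    ABIsomorphic ((planeFamily lam α δ hδ).fib z) (CanonicalTheme lam α α γ) ↔ γ = δ z := by
  have hβ : α * Complex.exp (z 0) = α := by simp [hz]
  change ABIsomorphic (CanonicalTheme lam α (α * Complex.exp (z 0)) (δ z)) _ ↔ _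
  rw [hβ]
  refine ⟨fun h => (eq_of_abIsomorphic h).2.2 rfl, ?_⟩
  rintro rfl
  exact ⟨LinearMap.id, fun _ => rfl, Function.bijective_id⟩

theorem isClassifyingMapAt_planeFamily (hα : α ≠ 0) {p : (Fin 2 → ℂ) → Fin 2 → ℂ}
    (hp : IsHolMapOn p Set.univ) (hp0 : ∀ z, p z 0 = z 0) {x : (Fin 2 → ℂ) → ℂ}
    (hx : ∀ z, IsHolAt x z)
    (hpδ : ∀ z, x z * (α * (Complex.exp (z 0) - 1)) = δ (p z) - δ' z) (z₀ : Fin 2 → ℂ) :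
    IsClassifyingMapAt (planeFamily lam α δ hδ) (p z₀) (planeFamily lam α δ' hδ') z₀ p :=
  (isCanonicalFormOn_id (isHolAt_const α) (isHolAt_plane_mul_exp α) hδ' (fun _ => hα)
    fun _ => mul_ne_zero hα (Complex.exp_ne_zero _)).isClassifyingMapAt isOpen_univ trivial _ _ _
      hp (fun z _ => hx z) (fun _ _ => rfl) (fun z _ => by rw [hp0])
      fun z _ => by rw [← hpδ, hp0]; ring

theorem not_isUniversalNear (hlam : 2 < lam) (hα : α ≠ 0) {γ : ℂ} {M : Type u}
    [TopologicalSpace M] [ReducedComplexSpace M] {𝔼 : ABFamily.{u, w} M} {x₀ : M}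
    (hiso : ABIsomorphic (𝔼.fib x₀) (CanonicalTheme lam α α γ)) :
    ¬ ABFamily.IsUniversalNear.{u, 0, w, 0} 𝔼 (fun _ : Fin 3 => lam) x₀ := by
  intro huniv
  have hδ := fun z => (isHolAt_const γ z).add (isHolAt_plane_coord 1 z)
  have hδ' := fun z => (isHolAt_const γ z).add ((isHolAt_plane_coord 1 z).mul
    ((isHolAt_plane_exp z).sub (isHolAt_const 1 z)))
  obtain ⟨⟨f, hf⟩, -⟩ := huniv _ (planeFamily lam α _ hδ) 0 (isHolFamily_planeFamily hlam hα)
    (((abIsomorphic_planeFamily_iff rfl).2 (by simp)).trans hiso.symm)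
  obtain ⟨-, huniq⟩ := huniv _ (planeFamily lam α _ hδ') 0 (isHolFamily_planeFamily hlam hα)
    (((abIsomorphic_planeFamily_iff rfl).2 (by simp)).trans hiso.symm)
  have hp := isClassifyingMapAt_planeFamily (lam := lam) (hδ := hδ) (hδ' := hδ') hα
    isHolMapOn_expBlowup (fun _ => rfl) (isHolAt_const 0) (fun z => by simp [expBlowup]) 0
  have hq := isClassifyingMapAt_planeFamily (lam := lam) (hδ := hδ) (hδ' := hδ') hα
    isHolMapOn_axisProj (fun _ => rfl)
    (fun z => (isHolAt_plane_coord 1 z).neg.mul (isHolAt_const α⁻¹ z))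
    (fun z => by simp [axisProj, mul_assoc, inv_mul_cancel_left₀ hα]) 0
  rw [expBlowup_zero] at hp
  rw [axisProj_zero] at hq
  have heq := huniq _ _ (hf.comp hp) (hf.comp hq)
  have hfib := hf.eventually_abIsomorphic
  obtain ⟨rfl, U, hU, h0, hfU, -⟩ := hf
  obtain ⟨t, ht, htf, htiso⟩ := exists_single_of_eventually 1
    ((eventuallyEq_comp_axisProj hfU hU h0 heq).and hfib) eventually_mem_nhdsWithin
  have hfix : f (Pi.single 1 t) = f 0 := htf.trans (congrArg f (axisProj_single_one t))
  rw [hfix] at htiso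
  have ht0 : γ = γ + t := by
    simpa using (abIsomorphic_planeFamily_iff (by simp)).1 (htiso.symm.trans hiso)
  exact ht (left_eq_add.1 ht0)

end NonUniversality

section Universality

open ReducedComplexSpace

/-- The space of the pairs `(α, β)` of distinct nonzero complex numbers, the base of the universal
family. -/
def ThemeParam : Type := {z : Fin 2 → ℂ // z 0 ≠ 0 ∧ z 1 ≠ 0 ∧ z 0 ≠ z 1}

noncomputable instance : TopologicalSpace ThemeParam := instTopologicalSpaceSubtype

theorem isOpenEmbedding_themeParam : IsOpenEmbedding (Subtype.val : ThemeParam → Fin 2 → ℂ) :=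
  ((isOpen_ne_fun (continuous_apply 0) continuous_const).inter
    ((isOpen_ne_fun (continuous_apply 1) continuous_const).inter
      (isOpen_ne_fun (continuous_apply 0) (continuous_apply 1)))).isOpenEmbedding_subtypeVal

/-- The complex structure on the space of pairs `(α, β)`, as an open subset of `ℂ²`. -/
noncomputable instance themeParamComplexSpace : ReducedComplexSpace ThemeParam :=
  ReducedComplexSpace.ofOpenEmbedding Subtype.val isOpenEmbedding_themeParam

theorem isHolAt_themeParam_coord (i : Fin 2) (x : ThemeParam) :
    IsHolAt (fun z : ThemeParam => z.1 i) x :=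
  ⟨fun z => z i, analyticAt_coord i _, .of_forall fun _ => rfl⟩

/-- The family over `ThemeParam` with fibers `E(α,β,0)`. -/
noncomputable def universalFamily (lam : ℚ) : ABFamily.{0, 0} ThemeParam :=
  canonicalFamily lam (fun z => z.1 0) (fun z => z.1 1) (fun _ => 0) (isHolAt_themeParam_coord 0)
    (isHolAt_themeParam_coord 1) (isHolAt_const 0)

theorem eq_of_abIsomorphic_universalFamily {lam : ℚ} {x : ThemeParam} {α β γ : ℂ}
    (h : ABIsomorphic (CanonicalTheme lam α β γ) ((universalFamily lam).fib x)) :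
    x.1 = ![α, β] := by
  obtain ⟨hα, hβ, -⟩ := eq_of_abIsomorphic (γ' := 0) h
  ext i
  fin_cases i
  exacts [hα, hβ]

theorem universalFamily_fib_injective {lam : ℚ} {x y : ThemeParam}
    (h : ABIsomorphic ((universalFamily lam).fib x) ((universalFamily lam).fib y)) : x = y := by
  refine Subtype.ext ((eq_of_abIsomorphic_universalFamily (γ := 0) h).trans ?_).symm
  ext i
  fin_cases i <;> rfl

variable {N : Type v} {α β γ : N → ℂ}

open Classical in
/-- The map to `ThemeParam` with coordinates `α` and `β`; it takes the junk value `x` where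
`(α, β)` is not in `ThemeParam`. -/
noncomputable def themeParamMap (α β : N → ℂ) (x : ThemeParam) (y : N) : ThemeParam :=
  if h : α y ≠ 0 ∧ β y ≠ 0 ∧ α y ≠ β y then ⟨![α y, β y], h⟩ else x

theorem themeParamMap_val {x : ThemeParam} {y : N} (hα : α y ≠ 0) (hβ : β y ≠ 0)
    (hαβ : α y ≠ β y) : (themeParamMap α β x y).1 = ![α y, β y] :=
  congrArg Subtype.val (dif_pos ⟨hα, hβ, hαβ⟩)

variable [TopologicalSpace N] [ReducedComplexSpace N]

theorem isHolMapOn_themeParamMap {V : Set N} (hV : IsOpen V)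
    (hα : ∀ y ∈ V, IsHolAt α y ∧ α y ≠ 0) (hβ : ∀ y ∈ V, IsHolAt β y ∧ β y ≠ 0)
    (hαβ : ∀ y ∈ V, α y ≠ β y) (x : ThemeParam) : IsHolMapOn (themeParamMap α β x) V := by
  refine isHolMapOn_ofOpenEmbedding isOpenEmbedding_themeParam fun y hy => ?_
  have hval : ∀ᶠ z in 𝓝 y, (themeParamMap α β x z).1 = ![α z, β z] :=
    mem_of_superset (hV.mem_nhds hy) fun z hz =>
      themeParamMap_val (hα z hz).2 (hβ z hz).2 (hαβ z hz)
  exact Fin.forall_fin_two.2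
    ⟨(hα y hy).1.congr (hval.mono fun z hz => (congrFun hz 0).symm),
      (hβ y hy).1.congr (hval.mono fun z hz => (congrFun hz 1).symm)⟩

theorem ABFamily.IsCanonicalFormOn.mono {ℍ : ABFamily.{v, w} N} {lam : ℚ}
    {Θ : ∀ y, CanonicalTheme lam (α y) (β y) (γ y) →ₗ[Cb] ℍ.fib y} {U V : Set N}
    (hΘ : ℍ.IsCanonicalFormOn Θ U) (hVU : V ⊆ U) : ℍ.IsCanonicalFormOn Θ V :=
  fun y hy => hΘ y (hVU hy)

theorem ABFamily.IsCanonicalFormOn.isOpen_inter_ne {ℍ : ABFamily.{v, w} N} {lam : ℚ}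
    {Θ : ∀ y, CanonicalTheme lam (α y) (β y) (γ y) →ₗ[Cb] ℍ.fib y} {U : Set N}
    (hΘ : ℍ.IsCanonicalFormOn Θ U) (hU : IsOpen U) : IsOpen (U ∩ {y | α y ≠ β y}) := by
  refine isOpen_iff_mem_nhds.2 fun y ⟨hy, hne⟩ => inter_mem (hU.mem_nhds hy) ?_
  obtain ⟨⟨hα, hβ, -⟩, -⟩ := hΘ y hy
  exact ((hα.sub hβ).continuousAt.eventually_ne (sub_ne_zero.2 hne)).mono fun _ => sub_ne_zero.1

theorem ABFamily.IsCanonicalFormOn.isClassifyingMapAt_universalFamily {ℍ : ABFamily.{v, w} N}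
    {lam : ℚ} {Θ : ∀ y, CanonicalTheme lam (α y) (β y) (γ y) →ₗ[Cb] ℍ.fib y} {V : Set N}
    (hΘ : ℍ.IsCanonicalFormOn Θ V) (hV : IsOpen V) (hαβ : ∀ y ∈ V, α y ≠ β y) {y₀ : N}
    (hy₀ : y₀ ∈ V) (x : ThemeParam) :
    IsClassifyingMapAt (universalFamily lam) (themeParamMap α β x y₀) ℍ y₀
      (themeParamMap α β x) := by
  have hα : ∀ y ∈ V, ReducedComplexSpace.IsHolAt α y ∧ α y ≠ 0 :=
    fun y hy => ⟨(hΘ y hy).1.1, (hΘ y hy).1.2.2.2.1⟩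
  have hβ : ∀ y ∈ V, ReducedComplexSpace.IsHolAt β y ∧ β y ≠ 0 :=
    fun y hy => ⟨(hΘ y hy).1.2.1, (hΘ y hy).1.2.2.2.2⟩
  have hval : ∀ y ∈ V, (themeParamMap α β x y).1 = ![α y, β y] := fun y hy =>
    themeParamMap_val (hα y hy).2 (hβ y hy).2 (hαβ y hy)
  have hne : ∀ y ∈ V, β y - α y ≠ 0 := fun y hy => sub_ne_zero.2 (hαβ y hy).symm
  refine hΘ.isClassifyingMapAt hV hy₀ _ _ _ (isHolMapOn_themeParamMap hV hα hβ hαβ x)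
    (x := fun y => (0 - γ y) / (β y - α y)) (fun y hy => ?_)
    (fun y hy => (congrFun (hval y hy) 0).symm) (fun y hy => (congrFun (hval y hy) 1).symm)
    fun y hy => ?_
  · exact ((isHolAt_const 0 y).sub (hΘ y hy).1.2.2.1).div ((hβ y hy).1.sub (hα y hy).1) (hne y hy)
  · rw [hval y hy]
    exact div_mul_cancel₀ _ (hne y hy)

theorem isUniversalNear_universalFamily {lam : ℚ} (hlam : 2 < lam) (x : ThemeParam) :
    ABFamily.IsUniversalNear.{0, u, 0, w} (universalFamily lam) (fun _ : Fin 3 => lam) x := by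
  refine fun N _ _ ℍ y₀ hH hiso => ⟨?_, fun f f' hf hf' => ?_⟩
  · obtain ⟨U, α, β, γ, Θ, hU, hy₀, hΘ⟩ := exists_isCanonicalFormOn hlam hH y₀
    obtain ⟨⟨-, -, -, hα, hβ⟩, hlin, hbij, -⟩ := hΘ y₀ hy₀
    have hx : x.1 = ![α y₀, β y₀] :=
      eq_of_abIsomorphic_universalFamily (ABIsomorphic.trans ⟨Θ y₀, hlin, hbij⟩ hiso)
    have hne : α y₀ ≠ β y₀ := by simpa [hx] using x.2.2.2
    have hf₀ : themeParamMap α β x y₀ = x :=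
      Subtype.ext ((themeParamMap_val hα hβ hne).trans hx.symm)
    have hf := (hΘ.mono Set.inter_subset_left).isClassifyingMapAt_universalFamily
      (hΘ.isOpen_inter_ne hU) (fun _ hy => hy.2) ⟨hy₀, hne⟩ x
    rw [hf₀] at hf
    exact ⟨_, hf⟩
  · filter_upwards [hf.eventually_abIsomorphic, hf'.eventually_abIsomorphic] with y h h'
    exact universalFamily_fib_injective (h.trans h'.symm)

end Universality

theorem proposition2p3p1 (lam : ℚ) (hlam : 2 < lam) :
    (∀ α β γ : ℂ, α ≠ 0 → β ≠ 0 →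
      IsThemeWithInvariants (fun _ : Fin 3 => lam) (CanonicalTheme lam α β γ)) ∧
    (∀ α β γ : ℂ, α ≠ 0 → β ≠ 0 → α ≠ β →
      ¬ IsInvariantTheme (CanonicalTheme lam α β γ) ∧
      ∃ α' β' γ' : ℂ, α' ≠ 0 ∧ β' ≠ 0 ∧ (α', β', γ') ≠ (α, β, γ) ∧
        ABIsomorphic (CanonicalTheme lam α β γ) (CanonicalTheme lam α' β' γ')) ∧
    (∀ α γ : ℂ, α ≠ 0 →
      IsInvariantTheme (CanonicalTheme lam α α γ) ∧
      ∀ (M : Type u) [TopologicalSpace M] [ReducedComplexSpace M] (𝔼 : ABFamily.{u, w} M) (x₀ : M),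
        𝔼.IsHolFamily (fun _ : Fin 3 => lam) →
        ABIsomorphic (𝔼.fib x₀) (CanonicalTheme lam α α γ) →
          ¬ ABFamily.IsUniversalNear.{u, 0, w, 0} 𝔼 (fun _ : Fin 3 => lam) x₀) ∧
    (∀ α β γ : ℂ, α ≠ 0 → β ≠ 0 → α ≠ β →
      ∃ (M : Type) (_ : TopologicalSpace M) (_ : ReducedComplexSpace M) (𝔼 : ABFamily.{0, 0} M),
        IsSmoothOfDim 2 M ∧
        𝔼.IsHolFamily (fun _ : Fin 3 => lam) ∧
        (∃ x₀ : M, ABIsomorphic (𝔼.fib x₀) (CanonicalTheme lam α β γ)) ∧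
        (∀ x : M, ABFamily.IsUniversalNear.{0, u, 0, w} 𝔼 (fun _ : Fin 3 => lam) x) ∧
        (∀ x y : M, ABIsomorphic (𝔼.fib x) (𝔼.fib y) → x = y)) := by
  refine ⟨fun α β γ hα hβ => isThemeWithInvariants_canonicalTheme hlam hα hβ γ,
    fun α β γ hα hβ hαβ => ⟨not_isInvariantTheme hαβ γ, α, β, γ + 1, hα, hβ, by simp,
      abIsomorphic_canonicalTheme hαβ γ (γ + 1)⟩,
    fun α γ hα => ⟨isInvariantTheme_canonicalTheme hα γ,
      fun M _ _ 𝔼 x₀ _ hiso => not_isUniversalNear hlam hα hiso⟩,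
    fun α β γ hα hβ hαβ => ⟨ThemeParam, inferInstance, inferInstance, universalFamily lam,
      isSmoothOfDim_ofOpenEmbedding _ isOpenEmbedding_themeParam,
      isHolFamily_canonicalFamily hlam _ _ _ (fun x => x.2.1) (fun x => x.2.2.1),
      ⟨⟨![α, β], hα, hβ, hαβ⟩, abIsomorphic_canonicalTheme hαβ 0 γ⟩,
      isUniversalNear_universalFamily hlam, fun _ _ => universalFamily_fib_injective⟩⟩
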